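/- Fix a network delay $\Delta\ge 0$ and rates $\lambda_h,\lambda_a>0$, and put $\lambda=\lambda_a/\lambda_h$ and $g=e^{-\lambda_h\Delta}$. Let honest blocks be mined at times $0=\tau_0<\tau_1<\tau_2<\cdots$, where block $0$ is the genesis block and the gaps $R_k=\tau_{k+1}-\tau_k$ are i.i.d. exponential random variables of rate $\lambda_h$. For each $i\ge 0$ let $\mathcal T_i$ be a random adversarial tree rooted at the $i$-th honest block, which starts to grow at time $\tau_i$: every block of the tree, from the moment it appears, gets children at the points of a Poisson process of rate $\lambda_a$. All these Poisson processes (for all trees and all blocks) are independent of each other and of $(R_k)_{k\ge0}$. Let $D_i(s)\in\mathbb N\cup\{\infty\}$ be the depth (maximal generation of a block) of $\mathcal T_i$ at time $\tau_i+s$. For $k\ge1$ the $k$-th honest block is called a non-tailgater if $\tau_k-\tau_{k-1}>\Delta$. Let $H_h(t)$ be the number of non-tailgater honest blocks with $k\ge 1$ and $\tau_k\le t$. For $0\le i<j$ let $$U_j=\{\tau_j-\tau_{j-1}>\Delta\}\cap\{\tau_{j+1}-\tau_j>\Delta\},\qquad \hat E_{ij}=\{D_i(t-\tau_i)<H_h(t-\Delta)-H_h(\tau_i)\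 \text{for all } t>\tau_j+\Delta\},$$ and for $j\ge1$ define the adversary-proof convergence event at the $j$-th honest block by $$\hat U_j=U_j\cap\bigcap_{0\le i<j}\hat E_{ij}.$$ If $\lambda e<g$, then, with probability $1$, the event $\hat U_j$ occurs for infinitely many $j$. -/

import Mathlib

open MeasureTheory ProbabilityTheory

namespace NakamotoPoS

/-- Mining time of the `k`-th honest block, where `R m` is the time between the honest blocks
`m` and `m + 1`. Block `0` is the genesis block, at time `0`. -/
def honestTime (R : ℕ → ℝ) (k : ℕ) : ℝ := ∑ m ∈ Finset.range k, R m

/-- Vertices of an adversarial tree are labelled by lists: `[]` is the root and `c :: p` is the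
child number `c` (counting from `0`, in order of appearance) of the vertex `p`. `W p c` is the time
between the appearances of the children `c - 1` and `c` of `p` (for `c = 0`: between the appearances
of `p` and of its first child). `birthTime W v` is the time at which `v` appears,
measured from the appearance of the root. -/
def birthTime (W : List ℕ → ℕ → ℝ) : List ℕ → ℝ
  | [] => 0
  | c :: p => birthTime W p + ∑ a ∈ Finset.range (c + 1), W p a

/-- The adversarial tree at time `t` after the appearance of its root. -/
def advTree (W : List ℕ → ℕ → ℝ) (t : ℝ) : Set (List ℕ) := {v | birthTime W v ≤ t}

/-- The depth of the adversarial tree at time `t` after the appearance of its root. -/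
noncomputable def advDepth (W : List ℕ → ℕ → ℝ) (t : ℝ) : ℕ∞ :=
  ⨆ v ∈ advTree W t, (v.length : ℕ∞)

/-- The `k`-th honest block (`k ≥ 1`) is a non-tailgater: it is mined more than `Δ` after the
previous honest block. -/
def NonTailgater (Δ : ℝ) (R : ℕ → ℝ) (k : ℕ) : Prop :=
  1 ≤ k ∧ Δ < honestTime R k - honestTime R (k - 1)

/-- The number of non-tailgater honest blocks mined up to time `t`. -/
noncomputable def nonTailgaterCount (Δ : ℝ) (R : ℕ → ℝ) (t : ℝ) : ℕ∞ :=
  {k : ℕ | NonTailgater Δ R k ∧ honestTime R k ≤ t}.encard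

/-- The `j`-th honest block is separated by more than `Δ` from the honest block before it and from
the honest block after it. -/
def Isolated (Δ : ℝ) (R : ℕ → ℝ) (j : ℕ) : Prop :=
  NonTailgater Δ R j ∧ Δ < honestTime R (j + 1) - honestTime R j

/-- At every time `t` later than `Δ` after the mining of the honest block `j`, the
adversarial tree rooted at the honest block `i` is less deep than the number of non-tailgater honest
blocks mined after block `i` and up to time `t - Δ`. -/
def NeverCatchesUp (Δ : ℝ) (R : ℕ → ℝ) (W : ℕ → List ℕ → ℕ → ℝ) (i j : ℕ) : Prop :=
  ∀ t : ℝ, honestTime R j + Δ < t →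
    advDepth (W i) (t - honestTime R i) <
      nonTailgaterCount Δ R (t - Δ) - nonTailgaterCount Δ R (honestTime R i)

/-- The adversary-proof convergence event at the honest block `j`. -/
def AdversaryProofConvergence (Δ : ℝ) (R : ℕ → ℝ) (W : ℕ → List ℕ → ℕ → ℝ) (j : ℕ) : Prop :=
  Isolated Δ R j ∧ ∀ i < j, NeverCatchesUp Δ R W i j

/-- The mining processes: the honest blocks form a Poisson process of rate `lamH`
(i.i.d. exponential gaps `R k`), and from each honest block `i` an independent adversarial tree
grows, in which every block gets its children according to an independent Poisson process of rate
`lamA` (i.i.d. exponential gaps `W i p c`). -/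
structure IsMiningModel {Ω : Type*} [MeasurableSpace Ω] (μ : Measure Ω) (lamH lamA : ℝ)
    (R : ℕ → Ω → ℝ) (W : ℕ → List ℕ → ℕ → Ω → ℝ) : Prop where
  honest_law : ∀ k, HasLaw (R k) (expMeasure lamH) μ
  adv_law : ∀ i p c, HasLaw (W i p c) (expMeasure lamA) μ
  indep : iIndepFun
    (Sum.elim R (fun q : ℕ × List ℕ × ℕ => W q.1 q.2.1 q.2.2)) μ

end NakamotoPoS

/-! A first-moment bound shows that generation `n` of an adversarial tree appears no earlier than
about `n / (e * lamA)`, while non-tailgaters arrive on average once per `1 / (lamH * g)`, with `g =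
exp (-lamH * Δ)`. The rate hypothesis leaves room for a pace `β` strictly between `1 / (lamH * g)`
and `1 / (e * lamA)`: honest growth is faster than one level per `β`, every tree is slower.

Call `j` good (`RaceGood`) when it is isolated, the honest gaps lag behind the pace `β` by at most
`K` on every window ending or starting at `j`, past windows contain a positive density of long gaps,
and each tree rooted at `i < j` is sparse from a generation growing linearly in `j - i`. This forces
the convergence event (`neverCatchesUp_of_sparseTree`). Chernoff bounds for walks with negative
drift bound the honest part from below uniformly in `j` (`exists_measure_honestGood_ge`). The trees
are independent of it and of each other, with positive success probabilities and failure
probabilities summable in `j - i`, so their product stays away from zero (`exists_pos_le_prod`).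
Hence infinitely many `j` are good with positive probability.

To reach probability one, the conditions are restricted to blocks `i ≥ n`. The union over `n` of the
resulting "infinitely often" events is a tail event, and a zero-one law applies. The finitely many
trees with `i < n` do no harm: almost surely each is sparse from some generation, which the honest
count eventually passes (`eventually_neverCatchesUp`). -/

namespace NakamotoPoS

open scoped ENNReal

/-! ### Moments and tail of the exponential law. -/

section ExponentialLaw

lemma lintegral_exp_mul_expMeasure {r t : ℝ} (hr : 0 < r) (ht : t < r) :
    ∫⁻ x, ENNReal.ofReal (Real.exp (t * x)) ∂(expMeasure r) = ENNReal.ofReal (r / (r - t)) := by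
  have hrt : 0 < r - t := sub_pos.2 ht
  have hdef : expMeasure r = volume.withDensity (exponentialPDF r) := rfl
  have hm : ∀ s, Measurable (exponentialPDF s) :=
    fun s => (measurable_exponentialPDFReal s).ennreal_ofReal
  rw [hdef, lintegral_withDensity_eq_lintegral_mul _ (hm r) (by fun_prop)]
  calc ∫⁻ x, (exponentialPDF r * fun x => ENNReal.ofReal (Real.exp (t * x))) x
      = ∫⁻ x, ENNReal.ofReal (r / (r - t)) * exponentialPDF (r - t) x := by
        refine lintegral_congr fun x => ?_
        rw [Pi.mul_apply, exponentialPDF_eq, exponentialPDF_eq]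
        split_ifs with h
        · rw [← ENNReal.ofReal_mul (by positivity), ← ENNReal.ofReal_mul (by positivity)]
          congr 1
          have : Real.exp (-((r - t) * x)) = Real.exp (-(r * x)) * Real.exp (t * x) := by
            rw [← Real.exp_add]; ring_nf
          rw [this]
          field_simp
        · simp
    _ = ENNReal.ofReal (r / (r - t)) := by
        rw [lintegral_const_mul _ (hm _), lintegral_exponentialPDF_eq_one hrt, mul_one]

lemma integrable_exp_mul_expMeasure {r t : ℝ} (hr : 0 < r) (ht : t < r) :
    Integrable (fun x => Real.exp (t * x)) (expMeasure r) := by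
  refine ⟨by fun_prop, ?_⟩
  rw [hasFiniteIntegral_iff_ofReal (ae_of_all _ fun x => (Real.exp_pos _).le),
    lintegral_exp_mul_expMeasure hr ht]
  exact ENNReal.ofReal_lt_top

lemma mgf_id_expMeasure {r t : ℝ} (hr : 0 < r) (ht : t < r) :
    mgf id (expMeasure r) t = r / (r - t) := by
  have hrt : 0 < r - t := sub_pos.2 ht
  rw [mgf, integral_eq_lintegral_of_nonneg_ae (ae_of_all _ fun x => (Real.exp_pos _).le)
    (by fun_prop)]
  simp only [id]
  rw [lintegral_exp_mul_expMeasure hr ht, ENNReal.toReal_ofReal (by positivity)]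

lemma integral_id_expMeasure {r : ℝ} (hr : 0 < r) : ∫ x, x ∂(expMeasure r) = 1 / r := by
  have hint : (0 : ℝ) ∈ interior (integrableExpSet id (expMeasure r)) := by
    rw [mem_interior]
    exact ⟨Set.Iio r, fun t ht => integrable_exp_mul_expMeasure hr ht, isOpen_Iio, hr⟩
  have h1 := deriv_mgf_zero hint
  have h2 : HasDerivAt (fun t => r / (r - t)) (1 / r) 0 := by
    have := ((hasDerivAt_id (0 : ℝ)).const_sub r).inv (by simpa using hr.ne')
    convert! this.const_mul r using 1
    simp only [id, sub_zero, neg_neg]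
    field_simp
  have h3 : mgf id (expMeasure r) =ᶠ[nhds 0] fun t => r / (r - t) := by
    filter_upwards [Iio_mem_nhds hr] with t ht using mgf_id_expMeasure hr ht
  rw [h3.deriv_eq, h2.deriv] at h1
  simpa using h1.symm

lemma expMeasure_real_Ioi {r x : ℝ} (hr : 0 < r) (hx : 0 ≤ x) :
    (expMeasure r).real (Set.Ioi x) = Real.exp (-(r * x)) := by
  have := isProbabilityMeasure_expMeasure hr
  have h := cdf_expMeasure_eq hr x
  rw [cdf_eq_real, if_pos hx] at h
  rw [← Set.compl_Iic, probReal_compl_eq_one_sub measurableSet_Iic, h]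
  ring

end ExponentialLaw

/-! ### First-moment bound for the growth of one adversarial tree. -/

section Tree

/-- The indices of the gaps which add up to the birth time of a vertex. -/
def birthIndex : List ℕ → Finset (List ℕ × ℕ)
  | [] => ∅
  | c :: p => birthIndex p ∪ {p} ×ˢ Finset.range (c + 1)

lemma length_lt_of_mem_birthIndex {v : List ℕ} {q : List ℕ × ℕ} (hq : q ∈ birthIndex v) :
    q.1.length < v.length := by
  induction v with
  | nil => simp [birthIndex] at hq
  | cons c p ih =>
    simp only [birthIndex, Finset.mem_union, Finset.mem_product, Finset.mem_singleton] at hq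
    rcases hq with hq | hq
    · exact (ih hq).trans (by simp)
    · simp [hq.1]

lemma disjoint_birthIndex (c : ℕ) (p : List ℕ) :
    Disjoint (birthIndex p) ({p} ×ˢ Finset.range (c + 1)) := by
  rw [Finset.disjoint_left]
  intro q hq hq'
  have := length_lt_of_mem_birthIndex hq
  simp only [Finset.mem_product, Finset.mem_singleton] at hq'
  simp [hq'.1] at this

lemma birthTime_eq_sum (W : List ℕ → ℕ → ℝ) (v : List ℕ) :
    birthTime W v = ∑ q ∈ birthIndex v, W q.1 q.2 := by
  induction v with
  | nil => simp [birthTime, birthIndex]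
  | cons c p ih =>
    rw [birthTime, birthIndex, Finset.sum_union (disjoint_birthIndex c p), ← ih,
      Finset.sum_product]
    simp

lemma card_birthIndex_cons (c : ℕ) (p : List ℕ) :
    (birthIndex (c :: p)).card = (birthIndex p).card + (c + 1) := by
  rw [birthIndex, Finset.card_union_of_disjoint (disjoint_birthIndex c p)]
  simp

/-- The first gap at the root precedes every other vertex, so making it large delays the whole tree.
-/
lemma root_mem_birthIndex {v : List ℕ} (hv : v ≠ []) : ([], 0) ∈ birthIndex v := by
  induction v with
  | nil => exact absurd rfl hv
  | cons c p ih =>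
    rw [birthIndex, Finset.mem_union]
    by_cases hp : p = []
    · right; simp [hp]
    · exact Or.inl (ih hp)

lemma tsum_pow_succ {ρ : ℝ≥0∞} : ∑' c : ℕ, ρ ^ (c + 1) = ρ * (1 - ρ)⁻¹ := by
  simp_rw [pow_succ', ENNReal.tsum_mul_left, ENNReal.tsum_geometric]

/-- A vertex of generation `n` is a tuple of `n` child numbers, and child number `c` contributes `c
+ 1` gaps, so the sum factorises into `n` geometric series. In use, `ρ` is the Laplace transform of
one gap. -/
lemma tsum_length_pow_card_birthIndex (ρ : ℝ≥0∞) (n : ℕ) :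
    ∑' v : {v : List ℕ // v.length = n}, ρ ^ (birthIndex v.1).card =
      (ρ * (1 - ρ)⁻¹) ^ n := by
  induction n with
  | zero =>
    have : Unique {v : List ℕ // v.length = 0} :=
      ⟨⟨⟨[], rfl⟩⟩, fun v => Subtype.ext (List.length_eq_zero_iff.1 v.2)⟩
    rw [tsum_eq_single (⟨[], rfl⟩ : {v : List ℕ // v.length = 0})
      fun v hv => absurd (Subsingleton.elim _ _) hv]
    simp [birthIndex]
  | succ n ih =>
    let e : ℕ × {v : List ℕ // v.length = n} ≃ {v : List ℕ // v.length = n + 1} :=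
      { toFun := fun x => ⟨x.1 :: x.2.1, by simp [x.2.2]⟩
        invFun := fun v => ⟨v.1.head (by rintro h; simpa [h] using v.2),
          ⟨v.1.tail, by simp [v.2]⟩⟩
        left_inv := fun x => by simp
        right_inv := fun v => by simp }
    rw [← e.tsum_eq, ENNReal.tsum_prod']
    simp only [e, Equiv.coe_fn_mk, card_birthIndex_cons, pow_add ρ (Finset.card _)]
    simp_rw [ENNReal.tsum_mul_right, ih]
    rw [ENNReal.tsum_mul_left, tsum_pow_succ, pow_succ]

variable {Ω : Type*} [MeasurableSpace Ω] {μ : Measure Ω}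

/-- Chernoff bound for the birth time of one vertex, on the event that the first gap at the root
is larger than `B`. -/
lemma measure_birthTime_le [IsProbabilityMeasure μ] {a θ : ℝ} (ha : 0 < a) (hθ : 0 < θ)
    {W : List ℕ → ℕ → Ω → ℝ} (hm : ∀ p c, Measurable (W p c))
    (hlaw : ∀ p c, HasLaw (W p c) (expMeasure a) μ)
    (hind : iIndepFun (fun q : List ℕ × ℕ => W q.1 q.2) μ) (B s : ℝ) {v : List ℕ} (hv : v ≠ []) :
    μ {ω | B < W [] 0 ω ∧ birthTime (fun p c => W p c ω) v ≤ s} ≤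
      ENNReal.ofReal (Real.exp (θ * s)) * (μ {ω | B < W [] 0 ω} * ENNReal.ofReal (Real.exp (-θ * B))
        * ENNReal.ofReal ((a + θ) / a)) * ENNReal.ofReal (a / (a + θ)) ^ (birthIndex v).card := by
  classical
  set ρ := ENNReal.ofReal (a / (a + θ)) with hρ
  have hρ1 : ENNReal.ofReal ((a + θ) / a) * ρ = 1 := by
    rw [hρ, ← ENNReal.ofReal_mul (by positivity), ← ENNReal.ofReal_one]
    congr 1
    field_simp
  -- The indicator of a root gap above `B` is absorbed into that gap's Chernoff weight, leaving a
  -- product of functions of independent gaps.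
  let f : List ℕ × ℕ → ℝ → ℝ≥0∞ := fun q x =>
    if q = ([], 0) then (Set.Ioi B).indicator (fun x => ENNReal.ofReal (Real.exp (-θ * x))) x
    else ENNReal.ofReal (Real.exp (-θ * x))
  have hf : ∀ q, Measurable (f q) := by
    intro q
    by_cases hq : q = ([], 0)
    · simp only [f, hq, if_true]
      exact Measurable.indicator (by fun_prop) measurableSet_Ioi
    · simp only [f, hq, if_false]
      fun_prop
  have hsub : {ω | B < W [] 0 ω ∧ birthTime (fun p c => W p c ω) v ≤ s} ⊆
      {ω | ENNReal.ofReal (Real.exp (-θ * s)) ≤ ∏ q ∈ birthIndex v, f q (W q.1 q.2 ω)} := by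
    rintro ω ⟨h1, h2⟩
    have h3 : ∀ q ∈ birthIndex v,
        f q (W q.1 q.2 ω) = ENNReal.ofReal (Real.exp (-θ * W q.1 q.2 ω)) := by
      intro q _
      by_cases hq : q = ([], 0)
      · simp only [f, hq, if_true]
        exact Set.indicator_of_mem h1 _
      · simp only [f, hq, if_false]
    rw [Set.mem_ofPred_eq, Finset.prod_congr rfl h3,
      ← ENNReal.ofReal_prod_of_nonneg (fun _ _ => (Real.exp_pos _).le), ← Real.exp_sum,
      ← Finset.mul_sum]
    rw [birthTime_eq_sum] at h2
    refine ENNReal.ofReal_le_ofReal (Real.exp_le_exp.2 ?_)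
    nlinarith
  have hprod : ∫⁻ ω, ∏ q ∈ birthIndex v, f q (W q.1 q.2 ω) ∂μ =
      ∏ q ∈ birthIndex v, ∫⁻ ω, f q (W q.1 q.2 ω) ∂μ :=
    lintegral_prod_eq_prod_lintegral_of_indepFun (birthIndex v)
      (fun q ω => f q (W q.1 q.2 ω)) (hind.comp f hf) fun q => (hf q).comp (hm _ _)
  have hfac : ∀ q ∈ (birthIndex v).erase ([], 0), ∫⁻ ω, f q (W q.1 q.2 ω) ∂μ = ρ := by
    intro q hq
    have hq' := Finset.ne_of_mem_erase hq
    simp only [f, hq', if_false]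
    have h1 := lintegral_map (μ := μ) (f := fun x => ENNReal.ofReal (Real.exp (-θ * x)))
      (by fun_prop) (hm q.1 q.2)
    rw [(hlaw q.1 q.2).map_eq, lintegral_exp_mul_expMeasure ha (by linarith)] at h1
    rw [← h1, hρ, sub_neg_eq_add]
  have hroot : ∫⁻ ω, f ([], 0) (W [] 0 ω) ∂μ ≤
      μ {ω | B < W [] 0 ω} * ENNReal.ofReal (Real.exp (-θ * B)) := by
    have hms : MeasurableSet {ω | B < W [] 0 ω} := measurableSet_lt measurable_const (hm _ _)
    rw [mul_comm, ← lintegral_indicator_const hms]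
    refine lintegral_mono fun ω => ?_
    simp only [f, if_true]
    by_cases h : B < W [] 0 ω
    · rw [Set.indicator_of_mem (show W [] 0 ω ∈ Set.Ioi B from h),
        Set.indicator_of_mem (show ω ∈ {ω | B < W [] 0 ω} from h)]
      exact ENNReal.ofReal_le_ofReal (Real.exp_le_exp.2 (by nlinarith))
    · rw [Set.indicator_of_notMem (show W [] 0 ω ∉ Set.Ioi B from h)]
      exact zero_le
  have hmem := root_mem_birthIndex hv
  -- The root gap was bounded separately; removing it from the power of `ρ` costs `1 / ρ = (a + θ) /
  -- a`.
  have hcard : ρ ^ ((birthIndex v).erase ([], 0)).card =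
      ENNReal.ofReal ((a + θ) / a) * ρ ^ (birthIndex v).card := by
    rw [← Finset.card_erase_add_one hmem, pow_succ', ← mul_assoc, hρ1, one_mul]
  have hmarkov := mul_meas_ge_le_lintegral (μ := μ)
    (f := fun ω => ∏ q ∈ birthIndex v, f q (W q.1 q.2 ω))
    (Finset.measurable_prod _ fun q _ => (hf q).comp (hm _ _)) (ENNReal.ofReal (Real.exp (-θ * s)))
  rw [hprod, ← Finset.mul_prod_erase _ _ hmem, Finset.prod_congr rfl hfac, Finset.prod_const,
    hcard] at hmarkov
  have hone : ENNReal.ofReal (Real.exp (θ * s)) * ENNReal.ofReal (Real.exp (-θ * s)) = 1 := by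
    rw [← ENNReal.ofReal_mul (Real.exp_pos _).le, ← Real.exp_add]
    simp
  calc _ ≤ _ := measure_mono hsub
    _ = ENNReal.ofReal (Real.exp (θ * s)) * (ENNReal.ofReal (Real.exp (-θ * s)) *
        μ {ω | ENNReal.ofReal (Real.exp (-θ * s)) ≤ ∏ q ∈ birthIndex v, f q (W q.1 q.2 ω)}) := by
        rw [← mul_assoc, hone, one_mul]
    _ ≤ _ := by
        rw [mul_assoc]
        refine mul_le_mul' le_rfl (hmarkov.trans ?_)
        rw [mul_assoc (_ * _)]
        gcongr

/-- No vertex of generation `n ≥ n₀` appears before time `β n + K`. -/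
def SparseTree (β K : ℝ) (n₀ : ℕ) (W : List ℕ → ℕ → ℝ) : Prop :=
  ∀ v : List ℕ, n₀ ≤ v.length → β * v.length + K < birthTime W v

lemma SparseTree.mono {β K : ℝ} {n₀ n₁ : ℕ} {W : List ℕ → ℕ → ℝ} (h : SparseTree β K n₀ W)
    (hn : n₀ ≤ n₁) : SparseTree β K n₁ W :=
  fun v hv => h v (hn.trans hv)

/-- Union bound over vertices, then over generations: generation `n` contributes a constant times
`(β * e * a) ^ n`. The factor `exp (-(B / β))` makes the bound small relative to the first-gap event
even for `n₀ = 1`. -/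
lemma measure_not_sparseTree_le [IsProbabilityMeasure μ] {a β K : ℝ} (ha : 0 < a) (hβ : 0 < β)
    (hβa : β * Real.exp 1 * a < 1)
    {W : List ℕ → ℕ → Ω → ℝ} (hm : ∀ p c, Measurable (W p c))
    (hlaw : ∀ p c, HasLaw (W p c) (expMeasure a) μ)
    (hind : iIndepFun (fun q : List ℕ × ℕ => W q.1 q.2) μ) (B : ℝ) {n₀ : ℕ} (hn₀ : 1 ≤ n₀) :
    μ {ω | B < W [] 0 ω ∧ ¬ SparseTree β K n₀ (fun p c => W p c ω)} ≤
      μ {ω | B < W [] 0 ω} * ENNReal.ofReal (Real.exp (-(B / β)) *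
        (Real.exp (K / β) * (1 + 1 / (a * β)) * (1 - β * Real.exp 1 * a)⁻¹)
          * (β * Real.exp 1 * a) ^ n₀) := by
  set q := β * Real.exp 1 * a with hq
  have hq0 : 0 < q := by positivity
  -- This `θ` minimises the growth factor per generation `exp (θ * β) * a / θ`, with minimum `β * e
  -- * a`.
  set θ := 1 / β with hθ
  have hθ0 : 0 < θ := by positivity
  set ρ := ENNReal.ofReal (a / (a + θ)) with hρ
  set M := μ {ω | B < W [] 0 ω} * ENNReal.ofReal (Real.exp (-θ * B))
        * ENNReal.ofReal ((a + θ) / a) with hM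
  clear_value M
  have hgeom : ρ * (1 - ρ)⁻¹ = ENNReal.ofReal (a * β) := by
    have h1 : 1 - ρ = ENNReal.ofReal (θ / (a + θ)) := by
      rw [hρ, ← ENNReal.ofReal_one, ← ENNReal.ofReal_sub _ (by positivity)]
      congr 1
      field_simp
      ring
    rw [h1, ← ENNReal.ofReal_inv_of_pos (by positivity), hρ, ← ENNReal.ofReal_mul (by positivity)]
    congr 1
    rw [hθ]
    field_simp
  have hgen : ∀ n : ℕ, μ (⋃ v : {v : List ℕ // v.length = n + n₀},
      {ω | B < W [] 0 ω ∧ birthTime (fun p c => W p c ω) v.1 ≤ β * v.1.length + K}) ≤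
      M * ENNReal.ofReal (Real.exp (K / β)) * ENNReal.ofReal q ^ (n + n₀) := by
    intro n
    calc _ ≤ ∑' v : {v : List ℕ // v.length = n + n₀},
          μ {ω | B < W [] 0 ω ∧ birthTime (fun p c => W p c ω) v.1 ≤ β * v.1.length + K} :=
          measure_iUnion_le _
      _ ≤ ∑' v : {v : List ℕ // v.length = n + n₀},
          ENNReal.ofReal (Real.exp (θ * (β * (n + n₀ : ℕ) + K))) * M *
            ρ ^ (birthIndex v.1).card := by
          refine ENNReal.tsum_le_tsum fun v => ?_
          have hv : v.1 ≠ [] := by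
            intro h
            have := v.2
            rw [h] at this
            simp at this
            omega
          have hl : v.1.length = n + n₀ := v.2
          rw [hl, hM]
          exact measure_birthTime_le ha hθ0 hm hlaw hind B _ hv
      _ = ENNReal.ofReal (Real.exp (θ * (β * (n + n₀ : ℕ) + K))) * M *
            ENNReal.ofReal (a * β) ^ (n + n₀) := by
          rw [ENNReal.tsum_mul_left, tsum_length_pow_card_birthIndex, hgeom]
      _ = _ := by
          have : θ * (β * (n + n₀ : ℕ) + K) = K / β + (n + n₀ : ℕ) * 1 := by
            rw [hθ]; field_simp; ring
          rw [this, Real.exp_add, Real.exp_nat_mul, ENNReal.ofReal_mul (Real.exp_pos _).le,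
            ENNReal.ofReal_pow (Real.exp_pos _).le, mul_comm (_ * _) M, mul_assoc, mul_assoc,
            mul_assoc, ← mul_pow, ← ENNReal.ofReal_mul (Real.exp_pos _).le]
          congr 4
          rw [hq]; ring
  have hsub : {ω | B < W [] 0 ω ∧ ¬ SparseTree β K n₀ (fun p c => W p c ω)} ⊆
      ⋃ n : ℕ, ⋃ v : {v : List ℕ // v.length = n + n₀},
      {ω | B < W [] 0 ω ∧ birthTime (fun p c => W p c ω) v.1 ≤ β * v.1.length + K} := by
    rintro ω ⟨h1, h2⟩
    simp only [SparseTree, not_forall, not_lt] at h2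
    obtain ⟨v, hv, h3⟩ := h2
    simp only [Set.mem_iUnion]
    exact ⟨v.length - n₀, ⟨v, by omega⟩, h1, h3⟩
  calc _ ≤ _ := measure_mono hsub
    _ ≤ _ := measure_iUnion_le _
    _ ≤ ∑' n : ℕ, M * ENNReal.ofReal (Real.exp (K / β)) * ENNReal.ofReal q ^ (n + n₀) :=
        ENNReal.tsum_le_tsum hgen
    _ = _ := by
        rw [ENNReal.tsum_mul_left]
        simp_rw [pow_add]
        rw [ENNReal.tsum_mul_right, ENNReal.tsum_geometric, ← ENNReal.ofReal_one,
          ← ENNReal.ofReal_sub _ hq0.le, ← ENNReal.ofReal_inv_of_pos (by linarith),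
          ← ENNReal.ofReal_pow hq0.le, hM]
        have h1q : 0 < 1 - q := by linarith
        simp only [mul_assoc]
        rw [← ENNReal.ofReal_mul (by positivity), ← ENNReal.ofReal_mul (by positivity),
          ← ENNReal.ofReal_mul (by positivity), ← ENNReal.ofReal_mul (by positivity)]
        congr 2
        rw [hθ]
        have : -(1 / β) * B = -(B / β) := by ring
        rw [this]
        field_simp

end Tree

/-! ### Chernoff bounds for walks with negative drift. -/

section Walk

/-- The mgf equals `1` at `0` and has the negative mean as its derivative there, so it dips below
`1` just to the right. -/
lemma exists_mgf_lt_one {Ω : Type*} [MeasurableSpace Ω] {μ : Measure Ω} [IsProbabilityMeasure μ]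
    {X : Ω → ℝ} (hX : 0 ∈ interior (integrableExpSet X μ)) (hneg : ∫ ω, X ω ∂μ < 0) :
    ∃ θ > 0, θ ∈ integrableExpSet X μ ∧ mgf X μ θ < 1 := by
  have hd : HasDerivAt (mgf X μ) (∫ ω, X ω ∂μ) 0 := by
    simpa using hasDerivAt_mgf hX
  have h1 := (hasDerivAt_iff_tendsto_slope.1 hd).eventually_lt_const hneg
  have h2 : ∀ᶠ θ in nhdsWithin (0 : ℝ) (Set.Ioi 0), slope (mgf X μ) 0 θ < 0 :=
    h1.filter_mono (nhdsWithin_mono _ fun x hx => (Set.mem_Ioi.1 hx).ne')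
  have h3 : ∀ᶠ θ in nhdsWithin (0 : ℝ) (Set.Ioi 0), θ ∈ integrableExpSet X μ :=
    (mem_interior_iff_mem_nhds.1 hX : _ ∈ nhds _) |> mem_nhdsWithin_of_mem_nhds
  obtain ⟨θ, h2, h3, hθ⟩ := (h2.and (h3.and self_mem_nhdsWithin)).exists
  refine ⟨θ, hθ, h3, ?_⟩
  rw [slope_def_field, mgf_zero, sub_zero, div_neg_iff] at h2
  have hθ' : 0 < θ := hθ
  rcases h2 with h2 | h2 <;> linarith

/-- Indicator of a gap longer than `Δ`. -/
noncomputable def longGap (Δ x : ℝ) : ℝ := (Set.Ioi Δ).indicator 1 x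

lemma longGap_nonneg (Δ x : ℝ) : 0 ≤ longGap Δ x :=
  Set.indicator_nonneg (fun _ _ => zero_le_one) _

lemma longGap_le_one (Δ x : ℝ) : longGap Δ x ≤ 1 :=
  Set.indicator_le_self' (fun _ _ => zero_le_one) _

@[fun_prop]
lemma measurable_longGap (Δ : ℝ) : Measurable (longGap Δ) :=
  measurable_one.indicator measurableSet_Ioi

lemma integral_longGap {r Δ : ℝ} (hr : 0 < r) (hΔ : 0 ≤ Δ) :
    ∫ x, longGap Δ x ∂(expMeasure r) = Real.exp (-(r * Δ)) := by
  unfold longGap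
  rw [integral_indicator_one measurableSet_Ioi, expMeasure_real_Ioi hr hΔ]

lemma integrable_longGap {r Δ : ℝ} (hr : 0 < r) : Integrable (longGap Δ) (expMeasure r) := by
  have := isProbabilityMeasure_expMeasure hr
  exact (integrable_const (1 : ℝ)).indicator measurableSet_Ioi

lemma integrable_id_expMeasure {r : ℝ} (hr : 0 < r) :
    Integrable (fun x => x) (expMeasure r) := by
  have hint : (0 : ℝ) ∈ interior (integrableExpSet id (expMeasure r)) := by
    rw [mem_interior]
    exact ⟨Set.Iio r, fun t ht => integrable_exp_mul_expMeasure hr ht, isOpen_Iio, hr⟩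
  exact integrable_of_mem_interior_integrableExpSet hint

lemma zero_mem_interior_integrableExpSet {r : ℝ} (hr : 0 < r) {f : ℝ → ℝ} (hf : Measurable f)
    {C : ℝ} (a : ℝ) (ha0 : 0 ≤ a) (ha1 : a ≤ 1) (hC : ∀ x, |f x - a * x| ≤ C) :
    0 ∈ interior (integrableExpSet f (expMeasure r)) := by
  rw [mem_interior]
  refine ⟨Set.Iio r, fun t ht => ?_, isOpen_Iio, hr⟩
  have hta : t * a < r := by
    rcases le_or_gt 0 t with h | h
    · exact (mul_le_of_le_one_right h ha1).trans_lt ht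
    · nlinarith
  refine ((integrable_exp_mul_expMeasure hr hta).const_mul (Real.exp (|t| * C))).mono'
    (by fun_prop) (ae_of_all _ fun x => ?_)
  rw [Real.norm_eq_abs, Real.abs_exp, ← Real.exp_add, Real.exp_le_exp]
  have h1 : t * (f x - a * x) ≤ |t| * C :=
    (le_abs_self _).trans (by rw [abs_mul]; exact mul_le_mul_of_nonneg_left (hC x) (abs_nonneg t))
  nlinarith

lemma exists_mgf_lt_one_sub_longGap {r Δ β : ℝ} (hr : 0 < r) (hΔ : 0 ≤ Δ) (hβ : 0 ≤ β)
    (h : 1 / r < β * Real.exp (-(r * Δ))) :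
    ∃ θ > 0, θ ∈ integrableExpSet (fun x => x - β * longGap Δ x) (expMeasure r) ∧
      mgf (fun x => x - β * longGap Δ x) (expMeasure r) θ < 1 := by
  have := isProbabilityMeasure_expMeasure hr
  refine exists_mgf_lt_one (zero_mem_interior_integrableExpSet hr (by fun_prop) (C := β) 1
    zero_le_one le_rfl fun x => ?_) ?_
  · have h1 := longGap_nonneg Δ x
    have h2 := longGap_le_one Δ x
    rw [abs_le]
    constructor <;> nlinarith
  · rw [integral_sub (integrable_id_expMeasure hr) ((integrable_longGap hr).const_mul _),
      integral_const_mul, integral_longGap hr hΔ, integral_id_expMeasure hr]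
    linarith

lemma exists_mgf_lt_one_const_sub_longGap {r Δ γ : ℝ} (hr : 0 < r) (hΔ : 0 ≤ Δ) (hγ : 0 ≤ γ)
    (h : γ < Real.exp (-(r * Δ))) :
    ∃ θ > 0, θ ∈ integrableExpSet (fun x => γ - longGap Δ x) (expMeasure r) ∧
      mgf (fun x => γ - longGap Δ x) (expMeasure r) θ < 1 := by
  have := isProbabilityMeasure_expMeasure hr
  refine exists_mgf_lt_one (zero_mem_interior_integrableExpSet hr (by fun_prop) (C := γ + 1) 0
    le_rfl zero_le_one fun x => ?_) ?_
  · have h1 := longGap_nonneg Δ x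
    have h2 := longGap_le_one Δ x
    rw [abs_le]
    constructor <;> nlinarith
  · rw [integral_sub (integrable_const _) (integrable_longGap hr), integral_longGap hr hΔ]
    simp only [integral_const, probReal_univ, one_smul]
    linarith

variable {Ω : Type*} [MeasurableSpace Ω] {μ : Measure Ω} [IsProbabilityMeasure μ]
  {R : ℕ → Ω → ℝ} {r : ℝ} {f : ℝ → ℝ} {θ : ℝ}

lemma measure_lt_sum_le (hm : ∀ k, Measurable (R k)) (hlaw : ∀ k, HasLaw (R k) (expMeasure r) μ)
    (hind : iIndepFun R μ) (hf : Measurable f) (hθ : 0 < θ)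
    (hint : θ ∈ integrableExpSet f (expMeasure r)) (K : ℝ) (s : Finset ℕ) :
    μ {ω | K < ∑ m ∈ s, f (R m ω)} ≤
      ENNReal.ofReal (Real.exp (-θ * K)) *
        ENNReal.ofReal (mgf f (expMeasure r) θ) ^ s.card := by
  have hindf : iIndepFun (fun m => f ∘ R m) μ := hind.comp (fun _ => f) fun _ => hf
  have hmgf : ∀ m, mgf (f ∘ R m) μ θ = mgf f (expMeasure r) θ := by
    intro m
    rw [← (hlaw m).map_eq, mgf_map (hm m).aemeasurable (by fun_prop)]
  have hi : ∀ m, Integrable (fun ω => Real.exp (θ * (f ∘ R m) ω)) μ := by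
    intro m
    have h : Integrable (fun x => Real.exp (θ * f x)) (μ.map (R m)) := by
      rw [(hlaw m).map_eq]; exact hint
    exact h.comp_measurable (hm m)
  have h1 := measure_ge_le_exp_mul_mgf (μ := μ) (X := ∑ m ∈ s, f ∘ R m) K hθ.le
    (hindf.integrable_exp_mul_sum (fun m => hf.comp (hm m)) fun m _ => hi m)
  rw [hindf.mgf_sum (fun m => hf.comp (hm m)), Finset.prod_congr rfl fun m _ => hmgf m,
    Finset.prod_const] at h1
  rw [← ENNReal.ofReal_pow mgf_nonneg, ← ENNReal.ofReal_mul (Real.exp_pos _).le]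
  refine (measure_mono fun ω (hω : K < _) => ?_).trans
    ((ENNReal.le_ofReal_iff_toReal_le (measure_ne_top _ _)
      (mul_nonneg (Real.exp_pos _).le (pow_nonneg mgf_nonneg _))).2 h1)
  simpa using hω.le

/-- A union bound over the window length gives a geometric series, hence an estimate uniform in `j`.
-/
lemma measure_exists_past_lt_sum_le (hm : ∀ k, Measurable (R k))
    (hlaw : ∀ k, HasLaw (R k) (expMeasure r) μ)
    (hind : iIndepFun R μ) (hf : Measurable f) (hθ : 0 < θ)
    (hint : θ ∈ integrableExpSet f (expMeasure r)) (K : ℝ) (j : ℕ) :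
    μ {ω | ∃ i < j, K < ∑ m ∈ Finset.Ico i j, f (R m ω)} ≤
      ENNReal.ofReal (Real.exp (-θ * K)) *
        (1 - ENNReal.ofReal (mgf f (expMeasure r) θ))⁻¹ := by
  rw [← ENNReal.tsum_geometric, ← ENNReal.tsum_mul_left]
  -- The clause `n ≤ j` is needed because `j - n` truncates: for larger `n` the window has only `j`
  -- terms and the power `n` would be unjustified.
  refine le_trans (le_trans (measure_mono ?_) (measure_iUnion_le
    (fun n : ℕ => {ω | K < ∑ m ∈ Finset.Ico (j - n) j, f (R m ω) ∧ n ≤ j})))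
    (ENNReal.tsum_le_tsum fun n => ?_)
  · rintro ω ⟨i, hi, h⟩
    refine Set.mem_iUnion.2 ⟨j - i, ?_, by omega⟩
    rwa [Nat.sub_sub_self hi.le]
  · by_cases hn : n ≤ j
    · have := measure_lt_sum_le hm hlaw hind hf hθ hint K (Finset.Ico (j - n) j)
      rw [Nat.card_Ico, Nat.sub_sub_self hn] at this
      simpa [hn] using this
    · simp [hn]

lemma measure_exists_future_lt_sum_le (hm : ∀ k, Measurable (R k))
    (hlaw : ∀ k, HasLaw (R k) (expMeasure r) μ)
    (hind : iIndepFun R μ) (hf : Measurable f) (hθ : 0 < θ)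
    (hint : θ ∈ integrableExpSet f (expMeasure r)) (K : ℝ) (j : ℕ) :
    μ {ω | ∃ k ≥ j, K < ∑ m ∈ Finset.Ico j k, f (R m ω)} ≤
      ENNReal.ofReal (Real.exp (-θ * K)) *
        (1 - ENNReal.ofReal (mgf f (expMeasure r) θ))⁻¹ := by
  rw [← ENNReal.tsum_geometric, ← ENNReal.tsum_mul_left]
  refine le_trans (le_trans (measure_mono ?_) (measure_iUnion_le
    (fun n : ℕ => {ω | K < ∑ m ∈ Finset.Ico j (j + n), f (R m ω)})))
    (ENNReal.tsum_le_tsum fun n => ?_)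
  · rintro ω ⟨k, hk, h⟩
    refine Set.mem_iUnion.2 ⟨k - j, ?_⟩
    simpa [Nat.add_sub_cancel' hk] using h
  · have := measure_lt_sum_le hm hlaw hind hf hθ hint K (Finset.Ico j (j + n))
    simpa using this

lemma tendsto_exp_neg_mul_const (hθ : 0 < θ) {C : ℝ≥0∞} (hC : C ≠ ⊤) :
    Filter.Tendsto (fun K : ℝ => ENNReal.ofReal (Real.exp (-θ * K)) * C) Filter.atTop (nhds 0) := by
  have h1 : Filter.Tendsto (fun K : ℝ => Real.exp (-θ * K)) Filter.atTop (nhds 0) :=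
    Real.tendsto_exp_atBot.comp
      (Filter.tendsto_id.const_mul_atTop_of_neg (neg_lt_zero.2 hθ))
  have h2 := ENNReal.Tendsto.mul_const (b := C) (ENNReal.tendsto_ofReal h1) (Or.inr hC)
  simpa using h2

end Walk

/-! ### Good honest blocks. -/

section Honest

/-- The block `j` is isolated, and around it the honest blocks from `n` on are mined at least as
fast as one non-tailgater per `β`, up to the additive error `K`. -/
def HonestGood (Δ β γ K : ℝ) (n j : ℕ) (R : ℕ → ℝ) : Prop :=
  (n < j ∧ Δ < R (j - 1) ∧ Δ < R j) ∧
  (∀ i < j, n ≤ i → ∑ m ∈ Finset.Ico i j, (R m - β * longGap Δ (R m)) ≤ K ∧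
    ∑ m ∈ Finset.Ico i j, (γ - longGap Δ (R m)) ≤ K) ∧
  ∀ k ≥ j, ∑ m ∈ Finset.Ico j k, (R m - β * longGap Δ (R m)) ≤ K

lemma HonestGood.mono {Δ β γ K : ℝ} {n n' j : ℕ} {R : ℕ → ℝ} (h : HonestGood Δ β γ K n j R)
    (hn : n ≤ n') (hj : n' < j) : HonestGood Δ β γ K n' j R :=
  ⟨⟨hj, h.1.2⟩, fun i hi hi' => h.2.1 i hi (hn.trans hi'), h.2.2⟩

/-- Only gaps of index at least `n` are assumed measurable, so that the event can be placed in a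
tail σ-algebra. The gap `j - 1` qualifies because the event is empty unless `n < j`. -/
lemma measurableSet_honestGood {Ω : Type*} [mΩ : MeasurableSpace Ω] {R : ℕ → Ω → ℝ} {n : ℕ}
    (hm : ∀ k, n ≤ k → Measurable (R k)) (Δ β γ K : ℝ) (j : ℕ) :
    MeasurableSet {ω | HonestGood Δ β γ K n j fun k => R k ω} := by
  by_cases hj : n < j
  · have h1 : Measurable (R (j - 1)) := hm _ (by omega)
    have h2 : Measurable (R j) := hm _ hj.le
    have hs : ∀ f : ℝ → ℝ, Measurable f → ∀ a b, n ≤ a →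
        MeasurableSet {ω | ∑ m ∈ Finset.Ico a b, f (R m ω) ≤ K} := by
      intro f hf a b ha
      refine measurableSet_le (Finset.measurable_fun_sum _ fun m hm' => hf.comp (hm m ?_))
        measurable_const
      exact ha.trans (Finset.mem_Ico.1 hm').1
    have hpast : MeasurableSet {ω | ∀ i < j, n ≤ i →
        ∑ m ∈ Finset.Ico i j, (R m ω - β * longGap Δ (R m ω)) ≤ K ∧
        ∑ m ∈ Finset.Ico i j, (γ - longGap Δ (R m ω)) ≤ K} := by
      simp only [Set.ofPred_forall]
      refine MeasurableSet.iInter fun i => .iInter fun _ => .iInter fun hi => ?_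
      exact (hs (fun x => x - β * longGap Δ x) (by fun_prop) i j hi).inter
        (hs (fun x => γ - longGap Δ x) (by fun_prop) i j hi)
    have hfuture : MeasurableSet {ω | ∀ k ≥ j,
        ∑ m ∈ Finset.Ico j k, (R m ω - β * longGap Δ (R m ω)) ≤ K} := by
      simp only [Set.ofPred_forall]
      exact MeasurableSet.iInter fun k => .iInter fun _ =>
        hs (fun x => x - β * longGap Δ x) (by fun_prop) j k hj.le
    exact ((MeasurableSet.const _).inter
        ((measurableSet_lt measurable_const h1).inter (measurableSet_lt measurable_const h2))).inter
      (hpast.inter hfuture)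
  · have : {ω | HonestGood Δ β γ K n j fun k => R k ω} = ∅ :=
      Set.eq_empty_of_forall_notMem fun ω h => hj h.1.1
    rw [this]
    exact MeasurableSet.empty

/-- Isolation has probability `g * g` whatever `K` is, while the three walk failures vanish as `K`
grows, uniformly in `j`. `K` is chosen so that they total less than half of `g * g`. -/
lemma exists_measure_honestGood_ge {Ω : Type*} [MeasurableSpace Ω] {μ : Measure Ω}
    [IsProbabilityMeasure μ] {R : ℕ → Ω → ℝ} {r Δ β γ : ℝ} (hm : ∀ k, Measurable (R k))
    (hlaw : ∀ k, HasLaw (R k) (expMeasure r) μ) (hind : iIndepFun R μ)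
    (hr : 0 < r) (hΔ : 0 ≤ Δ) (hβ : 0 ≤ β) (hγ : 0 ≤ γ)
    (hβr : 1 / r < β * Real.exp (-(r * Δ))) (hγr : γ < Real.exp (-(r * Δ))) :
    ∃ K ≥ 0, ∃ p : ℝ≥0∞, 0 < p ∧ ∀ j ≥ 1,
      p ≤ μ {ω | HonestGood Δ β γ K 0 j fun k => R k ω} := by
  obtain ⟨θ, hθ, hθi, hθm⟩ := exists_mgf_lt_one_sub_longGap hr hΔ hβ hβr
  obtain ⟨η, hη, hηi, hηm⟩ := exists_mgf_lt_one_const_sub_longGap hr hΔ hγ hγr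
  have hfin : ∀ x : ℝ, x < 1 → (1 - ENNReal.ofReal x)⁻¹ ≠ ⊤ := by
    intro x hx
    rw [Ne, ENNReal.inv_eq_top, tsub_eq_zero_iff_le, not_le]
    simpa using hx
  set g := ENNReal.ofReal (Real.exp (-(r * Δ))) with hg
  have hg0 : 0 < g := by rw [hg]; simpa using Real.exp_pos _
  have hlong : ∀ k, μ {ω | Δ < R k ω} = g := by
    intro k
    rw [(hlaw k).measure_eq (p := fun x => Δ < x) measurableSet_Ioi, hg,
      ← expMeasure_real_Ioi hr hΔ]
    have := isProbabilityMeasure_expMeasure hr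
    exact (ofReal_measureReal (measure_ne_top _ _)).symm
  have hT := ((tendsto_exp_neg_mul_const hθ (hfin _ hθm)).add
    ((tendsto_exp_neg_mul_const hη (hfin _ hηm)).add
      (tendsto_exp_neg_mul_const hθ (hfin _ hθm))))
  simp only [add_zero] at hT
  have hgg : 0 < g * g / 2 := by
    rw [ENNReal.div_pos_iff]
    exact ⟨(mul_ne_zero hg0.ne' hg0.ne'), by simp⟩
  obtain ⟨K, hK, hK0⟩ := ((hT.eventually_lt_const hgg).and (Filter.eventually_ge_atTop 0)).exists
  refine ⟨K, hK0, g * g / 2, hgg, fun j hj => ?_⟩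
  have hpair : μ ({ω | Δ < R (j - 1) ω} ∩ {ω | Δ < R j ω}) = g * g := by
    have h := (hind.indepFun (show j - 1 ≠ j by omega)).measure_inter_preimage_eq_mul
      (Set.Ioi Δ) (Set.Ioi Δ) measurableSet_Ioi measurableSet_Ioi
    have h1 := hlong (j - 1)
    have h2 := hlong j
    rw [← h1]
    nth_rw 2 [h1]
    rw [← h2]
    exact h
  have hsub : {ω | Δ < R (j - 1) ω} ∩ {ω | Δ < R j ω} ⊆
      {ω | HonestGood Δ β γ K 0 j fun k => R k ω} ∪
      ({ω | ∃ i < j, K < ∑ m ∈ Finset.Ico i j, (fun x => x - β * longGap Δ x) (R m ω)} ∪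
      ({ω | ∃ i < j, K < ∑ m ∈ Finset.Ico i j, (fun x => γ - longGap Δ x) (R m ω)} ∪
      {ω | ∃ k ≥ j, K < ∑ m ∈ Finset.Ico j k, (fun x => x - β * longGap Δ x) (R m ω)})) := by
    rintro ω ⟨h1, h2⟩
    by_contra hcon
    simp only [Set.mem_union, Set.mem_ofPred_eq, not_or, not_exists, not_and, not_lt] at hcon
    obtain ⟨h3, h4, h5, h6⟩ := hcon
    exact h3 ⟨⟨hj, h1, h2⟩, fun i hi _ => ⟨h4 i hi, h5 i hi⟩, h6⟩
  have hle := (measure_mono (μ := μ) hsub).trans ((measure_union_le _ _).trans (add_le_add le_rfl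
    ((measure_union_le _ _).trans (add_le_add le_rfl (measure_union_le _ _)))))
  rw [hpair] at hle
  have hle' := hle.trans (add_le_add le_rfl ((add_le_add
    (measure_exists_past_lt_sum_le hm hlaw hind (by fun_prop) hθ hθi K j)
    (add_le_add (measure_exists_past_lt_sum_le hm hlaw hind (by fun_prop) hη hηi K j)
    (measure_exists_future_lt_sum_le hm hlaw hind (by fun_prop) hθ hθi K j))).trans hK.le))
  have hgtop : g * g / 2 ≠ ⊤ := by
    refine ENNReal.div_ne_top (ENNReal.mul_ne_top ?_ ?_) (by simp) <;> simp [hg]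
  have hhalf := ENNReal.add_halves (g * g)
  exact (ENNReal.add_le_add_iff_right hgtop).1 (hhalf.le.trans hle')

end Honest

/-! ### Pathwise argument: good blocks give convergence events. -/

section Deterministic

open Filter

variable {Δ β γ K : ℝ} {R : ℕ → ℝ} {i j n : ℕ}

/-- The number of gaps longer than `Δ` with index in `[i, k)`. -/
noncomputable def longGapCount (Δ : ℝ) (R : ℕ → ℝ) (i k : ℕ) : ℕ :=
  ((Finset.Ico i k).filter fun m => Δ < R m).card

lemma cast_longGapCount (Δ : ℝ) (R : ℕ → ℝ) (i k : ℕ) :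
    (longGapCount Δ R i k : ℝ) = ∑ m ∈ Finset.Ico i k, longGap Δ (R m) := by
  rw [longGapCount, Finset.card_filter]
  push_cast
  exact Finset.sum_congr rfl fun m _ => by simp [longGap, Set.indicator_apply]

lemma longGapCount_add (Δ : ℝ) (R : ℕ → ℝ) {i j k : ℕ} (hij : i ≤ j) (hjk : j ≤ k) :
    longGapCount Δ R i j + longGapCount Δ R j k = longGapCount Δ R i k := by
  have h : ((longGapCount Δ R i j + longGapCount Δ R j k : ℕ) : ℝ) = longGapCount Δ R i k := by
    push_cast
    simp only [cast_longGapCount]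
    exact Finset.sum_Ico_consecutive _ hij hjk
  exact_mod_cast h

lemma honestTime_sub (R : ℕ → ℝ) {i k : ℕ} (h : i ≤ k) :
    honestTime R k - honestTime R i = ∑ m ∈ Finset.Ico i k, R m :=
  (Finset.sum_Ico_eq_sub _ h).symm

lemma honestTime_succ_sub (R : ℕ → ℝ) (k : ℕ) :
    honestTime R (k + 1) - honestTime R k = R k := by
  simp [honestTime, Finset.sum_range_succ]

lemma nonTailgater_succ_iff (k : ℕ) : NonTailgater Δ R (k + 1) ↔ Δ < R k := by
  simp [NonTailgater, honestTime_succ_sub]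

lemma strictMono_honestTime (hR : ∀ k, 0 < R k) : StrictMono (honestTime R) :=
  strictMono_nat_of_lt_succ fun k => by
    have := honestTime_succ_sub R k
    linarith [hR k]

lemma nonTailgaterCount_eq (hR : ∀ k, 0 < R k) {k : ℕ} {t : ℝ} (h1 : honestTime R k ≤ t)
    (h2 : t < honestTime R (k + 1)) :
    nonTailgaterCount Δ R t = longGapCount Δ R 0 k := by
  have hset : {m : ℕ | NonTailgater Δ R m ∧ honestTime R m ≤ t} =
      Nat.succ '' ((Finset.Ico 0 k).filter fun m => Δ < R m : Finset ℕ) := by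
    ext m
    simp only [Set.mem_ofPred_eq, Finset.coe_filter, Set.mem_image, Finset.mem_Ico]
    constructor
    · rintro ⟨hm, hmt⟩
      obtain ⟨l, rfl⟩ : ∃ l, m = l + 1 := ⟨m - 1, by have := hm.1; omega⟩
      have : l + 1 < k + 1 := (strictMono_honestTime hR).lt_iff_lt.1 (hmt.trans_lt h2)
      exact ⟨l, ⟨⟨Nat.zero_le _, by omega⟩, (nonTailgater_succ_iff l).1 hm⟩, rfl⟩
    · rintro ⟨l, ⟨⟨_, hlk⟩, hl⟩, rfl⟩
      exact ⟨(nonTailgater_succ_iff l).2 hl,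
        ((strictMono_honestTime hR).monotone (Nat.succ_le_of_lt hlk)).trans h1⟩
  rw [nonTailgaterCount, hset, Nat.succ_injective.encard_image, Set.encard_coe_eq_coe_finsetCard]
  rfl

lemma exists_honestTime_le_lt (htend : Tendsto (honestTime R) atTop atTop)
    {t : ℝ} (ht : honestTime R j ≤ t) :
    ∃ k ≥ j, honestTime R k ≤ t ∧ t < honestTime R (k + 1) := by
  classical
  have hex : ∃ k, j ≤ k ∧ t < honestTime R (k + 1) := by
    obtain ⟨N, hN⟩ := (htend.eventually_gt_atTop t).exists_forall_of_atTop
    exact ⟨max j N, le_max_left _ _, hN _ (by omega)⟩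
  refine ⟨Nat.find hex, (Nat.find_spec hex).1, ?_, (Nat.find_spec hex).2⟩
  rcases (Nat.find_spec hex).1.eq_or_lt with h | h
  · rwa [← h]
  · have h1 := Nat.find_min hex (m := Nat.find hex - 1) (by omega)
    rw [Nat.sub_add_cancel (by omega)] at h1
    by_contra hc
    exact h1 ⟨by omega, not_le.1 hc⟩

/-- If `t - Δ` lies between the honest times `k` and `k + 1`, the honest lead is the number `N` of
long gaps in `[i, k)`. The age of the tree is then below `β * N + K`, before any vertex of
generation at least `N` exists. -/
lemma neverCatchesUp_of_sparseTree (hR : ∀ k, 0 < R k)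
    (htend : Tendsto (honestTime R) atTop atTop) {W : ℕ → List ℕ → ℕ → ℝ} (hβ : 0 ≤ β)
    (hij : i < j) {n₀ : ℕ} (hn₀ : n₀ ≤ longGapCount Δ R i j) (h1 : 1 ≤ longGapCount Δ R i j)
    (hK : ∀ k ≥ j, ∑ m ∈ Finset.Ico i (k + 1), R m + Δ ≤ β * longGapCount Δ R i k + K)
    (hW : SparseTree β K n₀ (W i)) : NeverCatchesUp Δ R W i j := by
  intro t ht
  obtain ⟨k, hjk, hk1, hk2⟩ :=
    exists_honestTime_le_lt htend (show honestTime R j ≤ t - Δ by linarith)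
  rw [nonTailgaterCount_eq hR hk1 hk2, nonTailgaterCount_eq hR le_rfl
    (strictMono_honestTime hR (Nat.lt_succ_self i)),
    ← longGapCount_add Δ R (Nat.zero_le i) (hij.le.trans hjk)]
  have hmono := longGapCount_add Δ R hij.le hjk
  set N := longGapCount Δ R i k with hN
  have hdepth : advDepth (W i) (t - honestTime R i) ≤ ((N - 1 : ℕ) : ℕ∞) := by
    refine iSup₂_le fun v hv => ?_
    have hv' : birthTime (W i) v ≤ t - honestTime R i := hv
    by_contra hc
    rw [not_le, Nat.cast_lt] at hc
    have hlen : N ≤ v.length := by omega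
    have h2 := hW v (by omega)
    have h3 := hK k hjk
    rw [← honestTime_sub R (by omega : i ≤ k + 1)] at h3
    have h4 : β * (N : ℝ) ≤ β * v.length := by gcongr
    linarith
  refine hdepth.trans_lt ?_
  have hsub : ((longGapCount Δ R 0 i + N : ℕ) : ℕ∞) - (longGapCount Δ R 0 i : ℕ∞) = (N : ℕ∞) := by
    rw [← ENat.natCast_sub, Nat.add_sub_cancel_left]
  rw [hsub, Nat.cast_lt]
  omega

/-- The generation from which the tree at distance `l` has to be sparse. -/
noncomputable def sparseThreshold (γ K : ℝ) (l : ℕ) : ℕ := max 1 ⌈γ * l - K⌉₊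

/-- The window is cut at `j` into past and future. The gap `k` is included in the time but not in
the count, which costs the extra `β`. -/
lemma HonestGood.sum_add_le (h : HonestGood Δ β γ K n j R) (hβ : 0 ≤ β) {L : ℝ} (hij : i < j)
    (hL : ∑ m ∈ Finset.Ico i j, (R m - β * longGap Δ (R m)) ≤ L) {k : ℕ} (hk : j ≤ k) :
    ∑ m ∈ Finset.Ico i (k + 1), R m + Δ ≤ β * longGapCount Δ R i k + (L + K + β + Δ) := by
  have h1 := h.2.2 (k + 1) (by omega)
  have h2 := Finset.sum_Ico_consecutive (fun m => R m - β * longGap Δ (R m)) hij.le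
    (by omega : j ≤ k + 1)
  have h3 : ∑ m ∈ Finset.Ico i (k + 1), (R m - β * longGap Δ (R m)) =
      ∑ m ∈ Finset.Ico i (k + 1), R m - β * (longGapCount Δ R i k + longGap Δ (R k)) := by
    rw [Finset.sum_sub_distrib, ← Finset.mul_sum, cast_longGapCount,
      Finset.sum_Ico_succ_top (by omega : i ≤ k) (fun m => longGap Δ (R m))]
  have h4 := mul_le_mul_of_nonneg_left (longGap_le_one Δ (R k)) hβ
  linarith

/-- The gap `j - 1` is long by isolation, and the walk with steps `γ - longGap` gives the linear
bound. -/
lemma HonestGood.sparseThreshold_le (h : HonestGood Δ β γ K n j R) (hij : i < j) (hni : n ≤ i) :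
    sparseThreshold γ K (j - i) ≤ longGapCount Δ R i j := by
  refine max_le ?_ (Nat.ceil_le.2 ?_)
  · rw [Nat.one_le_iff_ne_zero, longGapCount, Finset.card_ne_zero]
    exact ⟨j - 1, Finset.mem_filter.2 ⟨Finset.mem_Ico.2 (by omega), h.1.2.1⟩⟩
  · have h1 := (h.2.1 i hij hni).2
    rw [Finset.sum_sub_distrib, ← cast_longGapCount] at h1
    simp only [Finset.sum_const, Nat.card_Ico, nsmul_eq_mul] at h1
    linarith

lemma HonestGood.isolated (h : HonestGood Δ β γ K n j R) : Isolated Δ R j := by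
  obtain ⟨⟨h1, h2, h3⟩, -⟩ := h
  obtain ⟨l, rfl⟩ : ∃ l, j = l + 1 := ⟨j - 1, by omega⟩
  exact ⟨(nonTailgater_succ_iff l).2 h2, by rwa [honestTime_succ_sub]⟩

/-- `HonestGood` together with sparsity of the trees rooted at the blocks from `n` to `j - 1`. -/
def RaceGood (Δ β γ K : ℝ) (n j : ℕ) (R : ℕ → ℝ) (W : ℕ → List ℕ → ℕ → ℝ) : Prop :=
  HonestGood Δ β γ K n j R ∧
    ∀ i < j, n ≤ i → SparseTree β (K + K + β + Δ) (sparseThreshold γ K (j - i)) (W i)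

lemma RaceGood.mono {n' : ℕ} {W : ℕ → List ℕ → ℕ → ℝ} (h : RaceGood Δ β γ K n j R W)
    (hn : n ≤ n') (hj : n' < j) : RaceGood Δ β γ K n' j R W :=
  ⟨h.1.mono hn hj, fun i hi hi' => h.2 i hi (hn.trans hi')⟩

lemma RaceGood.neverCatchesUp {W : ℕ → List ℕ → ℕ → ℝ} (h : RaceGood Δ β γ K n j R W)
    (hR : ∀ k, 0 < R k) (htend : Tendsto (honestTime R) atTop atTop) (hβ : 0 ≤ β)
    (hij : i < j) (hni : n ≤ i) : NeverCatchesUp Δ R W i j := by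
  have ht := h.1.sparseThreshold_le hij hni
  exact neverCatchesUp_of_sparseTree hR htend hβ hij ht ((le_max_left _ _).trans ht)
    (fun k hk => h.1.sum_add_le hβ hij (h.1.2.1 i hij hni).1 hk) (h.2 i hij hni)

/-- For a fixed `i < n` the deficit on `[i, n)` is a constant, absorbed into `L`. The tree is sparse
from some `n₀`, and the long gaps in `[n, j)` outnumber `n₀` once `j` is large. -/
lemma eventually_neverCatchesUp (hR : ∀ k, 0 < R k)
    (htend : Tendsto (honestTime R) atTop atTop) {W : ℕ → List ℕ → ℕ → ℝ} (hβ : 0 ≤ β)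
    (hγ : 0 < γ) (hin : i < n) (hW : ∀ L : ℕ, ∃ n₀, SparseTree β L n₀ (W i)) :
    ∀ᶠ j in atTop, RaceGood Δ β γ K n j R W → NeverCatchesUp Δ R W i j := by
  set A := ∑ m ∈ Finset.Ico i n, (R m - β * longGap Δ (R m)) with hA
  obtain ⟨L, hL⟩ := exists_nat_ge (A + K + K + β + Δ)
  obtain ⟨n₀, hn₀⟩ := hW L
  have hlim : Tendsto (fun j : ℕ => γ * ((j : ℝ) - n) - K) atTop atTop :=
    tendsto_atTop_add_const_right _ _
      ((tendsto_atTop_add_const_right _ _ tendsto_natCast_atTop_atTop).const_mul_atTop hγ)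
  filter_upwards [hlim.eventually_ge_atTop (n₀ : ℝ)] with j hj h
  have hnj := h.1.1.1
  have ht := h.1.sparseThreshold_le hnj le_rfl
  have hadd := longGapCount_add Δ R hin.le hnj.le
  have hn₀' : n₀ ≤ longGapCount Δ R n j := by
    refine le_trans ?_ ((le_max_right _ _).trans ht)
    rw [← Nat.cast_sub hnj.le] at hj
    exact_mod_cast hj.trans (Nat.le_ceil _)
  have h1 : 1 ≤ longGapCount Δ R n j := (le_max_left _ _).trans ht
  refine neverCatchesUp_of_sparseTree hR htend hβ (hin.trans hnj) (K := L)
    (by omega : n₀ ≤ _) (by omega) (fun k hk => ?_) hn₀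
  refine (h.1.sum_add_le hβ (hin.trans hnj) (L := A + K) ?_ hk).trans (by linarith)
  rw [← Finset.sum_Ico_consecutive _ hin.le hnj.le]
  linarith [(h.1.2.1 n hnj le_rfl).1]

lemma infinite_adversaryProofConvergence (hR : ∀ k, 0 < R k)
    (htend : Tendsto (honestTime R) atTop atTop) {W : ℕ → List ℕ → ℕ → ℝ} (hβ : 0 ≤ β)
    (hγ : 0 < γ) (hW : ∀ i, ∀ L : ℕ, ∃ n₀, SparseTree β L n₀ (W i))
    (hinf : ∃ᶠ j in atTop, RaceGood Δ β γ K n j R W) :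
    {j | AdversaryProofConvergence Δ R W j}.Infinite := by
  rw [← Nat.frequently_atTop_iff_infinite]
  have hev : ∀ᶠ j in atTop, ∀ i ∈ Finset.range n,
      RaceGood Δ β γ K n j R W → NeverCatchesUp Δ R W i j := by
    rw [Filter.eventually_all_finset]
    exact fun i hi => eventually_neverCatchesUp hR htend hβ hγ (Finset.mem_range.1 hi) (hW i)
  refine (hinf.and_eventually hev).mono fun j hj => ⟨hj.1.1.isolated, fun i hi => ?_⟩
  by_cases hin : i < n
  · exact hj.2 i (Finset.mem_range.2 hin) hj.1
  · exact hj.1.neverCatchesUp hR htend hβ hi (not_lt.1 hin)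

end Deterministic

open Filter

/-! ### Infinite products bounded away from zero. -/

section Product

lemma one_sub_sum_le_prod {f : ℕ → ℝ} (h0 : ∀ l, 0 < f l) (h1 : ∀ l, f l ≤ 1) (j : ℕ) :
    1 - ∑ l ∈ Finset.range j, (1 - f l) ≤ ∏ l ∈ Finset.range j, f l := by
  induction j with
  | zero => simp
  | succ j ih =>
    rw [Finset.sum_range_succ, Finset.prod_range_succ]
    have h2 : ∏ l ∈ Finset.range j, f l ≤ 1 :=
      Finset.prod_le_one (fun l _ => (h0 l).le) fun l _ => h1 l
    nlinarith [h1 j]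

/-- Beyond some `L` the defects sum to less than `1 / 2`, so the tail product exceeds `1 / 2`; the
head is a finite product of positive factors. -/
lemma exists_pos_le_prod {f : ℕ → ℝ} (h0 : ∀ l, 0 < f l) (h1 : ∀ l, f l ≤ 1)
    (hs : Summable fun l => 1 - f l) : ∃ p > 0, ∀ j, p ≤ ∏ l ∈ Finset.range j, f l := by
  obtain ⟨L, hL⟩ := ((tendsto_sum_nat_add fun l => 1 - f l).eventually_lt_const
    (show (0 : ℝ) < 1 / 2 by norm_num)).exists
  have hP : 0 < ∏ l ∈ Finset.range L, f l := Finset.prod_pos fun l _ => h0 l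
  refine ⟨(∏ l ∈ Finset.range L, f l) * (1 / 2), by positivity, fun j => ?_⟩
  have h2 : ∏ l ∈ Finset.range (L + j), f l ≤ ∏ l ∈ Finset.range j, f l := by
    rw [add_comm, Finset.prod_range_add]
    exact mul_le_of_le_one_right (Finset.prod_nonneg fun l _ => (h0 l).le)
      (Finset.prod_le_one (fun l _ => (h0 _).le) fun l _ => h1 _)
  refine le_trans ?_ h2
  rw [Finset.prod_range_add]
  refine mul_le_mul_of_nonneg_left ?_ hP.le
  have h3 := one_sub_sum_le_prod (f := fun l => f (L + l)) (fun l => h0 _) (fun l => h1 _) j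
  have h4 : ∑ l ∈ Finset.range j, (1 - f (l + L)) ≤ ∑' l, (1 - f (l + L)) :=
    ((summable_nat_add_iff L).2 hs).sum_le_tsum _ fun l _ => sub_nonneg.2 (h1 _)
  simp only [add_comm _ L] at h4 hL
  linarith

end Product

/-! ### Probability that a tree is sparse. -/

section TreeProbability

variable {Ω : Type*} [mΩ : MeasurableSpace Ω] {μ : Measure Ω}

lemma measurable_birthTime {W : List ℕ → ℕ → Ω → ℝ} (hm : ∀ p c, Measurable (W p c))
    (v : List ℕ) : Measurable fun ω => birthTime (fun p c => W p c ω) v := by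
  simp only [birthTime_eq_sum]
  exact Finset.measurable_fun_sum _ fun q _ => hm _ _

lemma measurableSet_sparseTree {W : List ℕ → ℕ → Ω → ℝ} (hm : ∀ p c, Measurable (W p c))
    (β K : ℝ) (n₀ : ℕ) : MeasurableSet {ω | SparseTree β K n₀ fun p c => W p c ω} := by
  simp only [SparseTree, Set.ofPred_forall]
  exact MeasurableSet.iInter fun v => .iInter fun _ =>
    measurableSet_lt measurable_const (measurable_birthTime hm v)

lemma measureReal_lt_gap [IsProbabilityMeasure μ] {a B : ℝ} (ha : 0 < a) (hB : 0 ≤ B)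
    {X : Ω → ℝ} (hlaw : HasLaw X (expMeasure a) μ) :
    μ.real {ω | B < X ω} = Real.exp (-(a * B)) := by
  rw [hlaw.measureReal_eq (p := fun x => B < x) measurableSet_Ioi, ← expMeasure_real_Ioi ha hB]
  rfl

/-- The constant in the bound for the probability that a tree is not sparse. -/
noncomputable def sparseConst (a β K : ℝ) : ℝ :=
  Real.exp (K / β) * (1 + 1 / (a * β)) * (1 - β * Real.exp 1 * a)⁻¹

lemma sparseConst_pos {a β : ℝ} (ha : 0 < a) (hβ : 0 < β) (hβa : β * Real.exp 1 * a < 1) (K : ℝ) :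
    0 < sparseConst a β K := by
  have : 0 < 1 - β * Real.exp 1 * a := by linarith
  unfold sparseConst
  positivity

/-- `B = 0` gives a bound tending to `1` as `n₀` grows; a large `B` gives a positive bound already
for `n₀ = 1`. -/
lemma measureReal_sparseTree_ge [IsProbabilityMeasure μ] {a β : ℝ} (K : ℝ) (ha : 0 < a)
    (hβ : 0 < β) (hβa : β * Real.exp 1 * a < 1)
    {W : List ℕ → ℕ → Ω → ℝ} (hm : ∀ p c, Measurable (W p c))
    (hlaw : ∀ p c, HasLaw (W p c) (expMeasure a) μ)
    (hind : iIndepFun (fun q : List ℕ × ℕ => W q.1 q.2) μ) {B : ℝ} (hB : 0 ≤ B)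
    {n₀ : ℕ} (hn₀ : 1 ≤ n₀) :
    Real.exp (-(a * B)) *
        (1 - Real.exp (-(B / β)) * sparseConst a β K * (β * Real.exp 1 * a) ^ n₀) ≤
      μ.real {ω | SparseTree β K n₀ fun p c => W p c ω} := by
  have h := measure_not_sparseTree_le (K := K) ha hβ hβa hm hlaw hind B hn₀
  have hC := sparseConst_pos ha hβ hβa K
  rw [← ofReal_measureReal (measure_ne_top _ _), ← ofReal_measureReal (measure_ne_top _ _),
    ← ENNReal.ofReal_mul measureReal_nonneg, measureReal_lt_gap ha hB (hlaw [] 0),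
    ← sparseConst, ENNReal.ofReal_le_ofReal_iff (by positivity)] at h
  have hsub : {ω | B < W [] 0 ω} ⊆
      {ω | B < W [] 0 ω ∧ ¬ SparseTree β K n₀ fun p c => W p c ω} ∪
      {ω | SparseTree β K n₀ fun p c => W p c ω} := by
    intro ω hω
    by_cases h : SparseTree β K n₀ fun p c => W p c ω
    · exact Or.inr h
    · exact Or.inl ⟨hω, h⟩
  have h2 := (measureReal_mono (μ := μ) hsub).trans (measureReal_union_le _ _)
  rw [measureReal_lt_gap ha hB (hlaw [] 0)] at h2
  linarith

lemma ae_exists_sparseTree [IsProbabilityMeasure μ] {a β : ℝ} (K : ℝ) (ha : 0 < a)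
    (hβ : 0 < β) (hβa : β * Real.exp 1 * a < 1)
    {W : List ℕ → ℕ → Ω → ℝ} (hm : ∀ p c, Measurable (W p c))
    (hlaw : ∀ p c, HasLaw (W p c) (expMeasure a) μ)
    (hind : iIndepFun (fun q : List ℕ × ℕ => W q.1 q.2) μ) :
    ∀ᵐ ω ∂μ, ∃ n₀, SparseTree β K n₀ fun p c => W p c ω := by
  have hq : 0 < β * Real.exp 1 * a := by positivity
  have hms : MeasurableSet {ω | ∃ n₀, SparseTree β K n₀ fun p c => W p c ω} := by
    rw [Set.ofPred_exists]
    exact MeasurableSet.iUnion fun n₀ => measurableSet_sparseTree hm β K n₀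
  have h1 : ∀ n : ℕ, 1 - sparseConst a β K * (β * Real.exp 1 * a) ^ (n + 1) ≤
      μ.real {ω | ∃ n₀, SparseTree β K n₀ fun p c => W p c ω} := by
    intro n
    have := measureReal_sparseTree_ge K ha hβ hβa hm hlaw hind le_rfl (Nat.le_add_left 1 n)
    simp only [mul_zero, neg_zero, Real.exp_zero, zero_div, one_mul] at this
    exact this.trans (measureReal_mono fun ω hω => ⟨_, hω⟩)
  have h2 : Tendsto (fun n : ℕ => 1 - sparseConst a β K * (β * Real.exp 1 * a) ^ (n + 1)) atTop
      (nhds (1 - sparseConst a β K * 0)) :=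
    (((tendsto_pow_atTop_nhds_zero_of_lt_one hq.le hβa).comp (tendsto_add_atTop_nat 1)).const_mul
      _).const_sub _
  have h3 := le_of_tendsto' h2 h1
  rw [mul_zero, sub_zero] at h3
  have h4 : μ.real {ω | ∃ n₀, SparseTree β K n₀ fun p c => W p c ω} = 1 :=
    le_antisymm measureReal_le_one h3
  rw [ae_iff_measure_eq hms.nullMeasurableSet, measure_univ]
  rw [measureReal_def, ENNReal.toReal_eq_one_iff] at h4
  exact h4

/-- `f` is the maximum of two bounds: the one with large `B` keeps every factor positive, and the
one with `B = 0` makes `1 - f l` at most a constant times `q ^ (γ * l)`, hence summable. -/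
lemma exists_measureReal_sparseThreshold_ge [IsProbabilityMeasure μ] {a β γ : ℝ} (K K' : ℝ)
    (ha : 0 < a) (hβ : 0 < β) (hγ : 0 < γ) (hβa : β * Real.exp 1 * a < 1)
    {W : ℕ → List ℕ → ℕ → Ω → ℝ} (hm : ∀ i p c, Measurable (W i p c))
    (hlaw : ∀ i p c, HasLaw (W i p c) (expMeasure a) μ)
    (hind : ∀ i, iIndepFun (fun q : List ℕ × ℕ => W i q.1 q.2) μ) :
    ∃ f : ℕ → ℝ, (∀ l, 0 < f l) ∧ (∀ l, f l ≤ 1) ∧ (Summable fun l => 1 - f l) ∧ ∀ i l,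
      f l ≤ μ.real {ω | SparseTree β K' (sparseThreshold γ K l) fun p c => W i p c ω} := by
  set q := β * Real.exp 1 * a with hq
  have hq0 : 0 < q := by positivity
  set C := sparseConst a β K' with hC
  have hC0 : 0 < C := sparseConst_pos ha hβ hβa K'
  obtain ⟨B, hB, hB0⟩ : ∃ B : ℝ, Real.exp (-(B / β)) * C * q ^ 1 < 1 / 2 ∧ 0 ≤ B := by
    have h1 : Tendsto (fun B : ℝ => Real.exp (-(B / β)) * C * q ^ 1) atTop (nhds (0 * C * q ^ 1)) :=
      ((Real.tendsto_exp_neg_atTop_nhds_zero.comp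
        (tendsto_id.atTop_div_const hβ)).mul_const _).mul_const _
    rw [zero_mul, zero_mul] at h1
    exact ((h1.eventually_lt_const (by norm_num)).and (eventually_ge_atTop 0)).exists
  have hge : ∀ i l, max (Real.exp (-(a * B)) * (1 / 2)) (1 - C * q ^ sparseThreshold γ K l) ≤
      μ.real {ω | SparseTree β K' (sparseThreshold γ K l) fun p c => W i p c ω} := by
    intro i l
    have hl : 1 ≤ sparseThreshold γ K l := le_max_left _ _
    refine max_le ?_ ?_
    · have h1 := measureReal_sparseTree_ge K' ha hβ hβa (hm i) (hlaw i) (hind i) hB0 le_rfl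
      refine le_trans ?_ (h1.trans (measureReal_mono fun ω hω => SparseTree.mono hω hl))
      exact mul_le_mul_of_nonneg_left (by linarith) (Real.exp_pos _).le
    · have h1 := measureReal_sparseTree_ge K' ha hβ hβa (hm i) (hlaw i) (hind i) le_rfl hl
      simpa using h1
  refine ⟨_, fun l => lt_max_of_lt_left (by positivity), fun l => (hge 0 l).trans
    measureReal_le_one, ?_, hge⟩
  have hqγ : q ^ γ < 1 := Real.rpow_lt_one hq0.le hβa hγ
  refine Summable.of_nonneg_of_le (fun l => sub_nonneg.2 ((hge 0 l).trans measureReal_le_one))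
    (fun l => ?_) ((summable_geometric_of_lt_one (by positivity) hqγ).mul_left (C * q ^ (-K)))
  have h1 : q ^ sparseThreshold γ K l ≤ q ^ (-K) * (q ^ γ) ^ l := by
    rw [← Real.rpow_natCast q, ← Real.rpow_natCast (q ^ γ), ← Real.rpow_mul hq0.le,
      ← Real.rpow_add hq0]
    refine Real.rpow_le_rpow_of_exponent_ge hq0 hβa.le ?_
    have h2 : γ * l - K ≤ (sparseThreshold γ K l : ℝ) :=
      (Nat.le_ceil _).trans (Nat.cast_le.2 (le_max_right _ _))
    linarith
  have h2 := le_max_right (Real.exp (-(a * B)) * (1 / 2)) (1 - C * q ^ sparseThreshold γ K l)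
  have h3 := mul_le_mul_of_nonneg_left h1 hC0.le
  linarith

end TreeProbability

/-! ### Almost sure regularity of the honest times. -/

section HonestProbability

variable {Ω : Type*} [MeasurableSpace Ω] {μ : Measure Ω} [IsProbabilityMeasure μ]

lemma ae_gap_pos {a : ℝ} (ha : 0 < a) {X : Ω → ℝ} (hm : Measurable X)
    (hlaw : HasLaw X (expMeasure a) μ) : ∀ᵐ ω ∂μ, 0 < X ω := by
  have h := measureReal_lt_gap ha le_rfl hlaw
  rw [mul_zero, neg_zero, Real.exp_zero, measureReal_def, ENNReal.toReal_eq_one_iff] at h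
  rw [ae_iff_measure_eq (measurableSet_lt measurable_const hm).nullMeasurableSet, measure_univ]
  exact h

/-- A Chernoff bound for the negated gaps makes the probability that the `k`-th time is below `M`
decay geometrically in `k`. -/
lemma ae_tendsto_honestTime {r : ℝ} (hr : 0 < r) {R : ℕ → Ω → ℝ} (hm : ∀ k, Measurable (R k))
    (hlaw : ∀ k, HasLaw (R k) (expMeasure r) μ) (hind : iIndepFun R μ) :
    ∀ᵐ ω ∂μ, Tendsto (honestTime fun k => R k ω) atTop atTop := by
  have hmgf : mgf (fun x : ℝ => -x) (expMeasure r) 1 < 1 := by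
    have h1 : mgf (fun x : ℝ => -x) (expMeasure r) 1 = mgf id (expMeasure r) (-1) := by
      simp [mgf]
    rw [h1, mgf_id_expMeasure hr (by linarith), div_lt_one (by linarith)]
    linarith
  have hint : (1 : ℝ) ∈ integrableExpSet (fun x : ℝ => -x) (expMeasure r) := by
    have := integrable_exp_mul_expMeasure hr (show (-1 : ℝ) < r by linarith)
    simpa [integrableExpSet] using this
  have hunb : ∀ M : ℕ, ∀ᵐ ω ∂μ, ∃ k, (M : ℝ) ≤ honestTime (fun k => R k ω) k := by
    intro M
    rw [ae_iff]
    have hle : ∀ k : ℕ, μ {ω | ¬ ∃ k, (M : ℝ) ≤ honestTime (fun k => R k ω) k} ≤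
        ENNReal.ofReal (Real.exp (-1 * (-M : ℝ))) *
          ENNReal.ofReal (mgf (fun x : ℝ => -x) (expMeasure r) 1) ^ k := by
      intro k
      have h := measure_lt_sum_le hm hlaw hind (f := fun x => -x) measurable_neg one_pos hint
        (-M : ℝ) (Finset.range k)
      rw [Finset.card_range] at h
      refine (measure_mono fun ω hω => ?_).trans h
      simp only [Set.mem_ofPred_eq, not_exists, not_le, Finset.sum_neg_distrib] at hω ⊢
      have := hω k
      rw [honestTime] at this
      linarith
    have hlim : Tendsto (fun k : ℕ => ENNReal.ofReal (Real.exp (-1 * (-M : ℝ))) *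
        ENNReal.ofReal (mgf (fun x : ℝ => -x) (expMeasure r) 1) ^ k) atTop
        (nhds (ENNReal.ofReal (Real.exp (-1 * (-M : ℝ))) * 0)) :=
      ENNReal.Tendsto.const_mul (ENNReal.tendsto_pow_atTop_nhds_zero_of_lt_one (by simpa using hmgf))
        (Or.inr ENNReal.ofReal_ne_top)
    have := ge_of_tendsto' hlim hle
    simpa using this
  filter_upwards [ae_all_iff.2 hunb, ae_all_iff.2 fun k => ae_gap_pos hr (hm k) (hlaw k)]
    with ω h1 h2
  refine tendsto_atTop_atTop_of_monotone (strictMono_honestTime h2).monotone fun x => ?_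
  obtain ⟨M, hM⟩ := exists_nat_ge x
  obtain ⟨k, hk⟩ := h1 M
  exact ⟨k, hM.trans hk⟩

end HonestProbability

/-- Reverse Fatou for sets, by continuity from above along the decreasing tail unions. -/
lemma le_measure_frequently {Ω : Type*} [MeasurableSpace Ω] {μ : Measure Ω} [IsFiniteMeasure μ]
    {G : ℕ → Set Ω} (hG : ∀ j, MeasurableSet (G j)) {p : ℝ≥0∞} (hp : ∀ᶠ j in atTop, p ≤ μ (G j)) :
    p ≤ μ {ω | ∃ᶠ j in atTop, ω ∈ G j} := by
  have hset : {ω | ∃ᶠ j in atTop, ω ∈ G j} = ⋂ n : ℕ, ⋃ j ≥ n, G j := by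
    ext ω
    simp [frequently_atTop]
  have hanti : Antitone fun n : ℕ => ⋃ j ≥ n, G j := fun a b hab =>
    Set.biUnion_subset_biUnion_left fun j hj => le_trans hab hj
  rw [hset]
  refine ge_of_tendsto (tendsto_measure_iInter_atTop (fun n => (MeasurableSet.iUnion fun j =>
    MeasurableSet.iUnion fun _ => hG j).nullMeasurableSet) hanti ⟨0, measure_ne_top _ _⟩) ?_
  filter_upwards [hp] with n hn
  exact hn.trans (measure_mono 
    (Set.subset_biUnion_of_mem (u := G) (s := {j | j ≥ n}) (by simp)))

/-! ### Independence of disjoint sets of gaps, and the zero-one law. -/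

section Independence

variable {Ω : Type*}

/-- All gaps of the model in one family. -/
def gapFamily (R : ℕ → Ω → ℝ) (W : ℕ → List ℕ → ℕ → Ω → ℝ) :
    ℕ ⊕ (ℕ × List ℕ × ℕ) → Ω → ℝ :=
  Sum.elim R fun q => W q.1 q.2.1 q.2.2

/-- The σ-algebra generated by the gaps with index in `S`. -/
@[reducible]
def gapSigma (R : ℕ → Ω → ℝ) (W : ℕ → List ℕ → ℕ → Ω → ℝ) (S : Set (ℕ ⊕ (ℕ × List ℕ × ℕ))) :
    MeasurableSpace Ω :=
  ⨆ q ∈ S, MeasurableSpace.comap (gapFamily R W q) inferInstance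

variable {R : ℕ → Ω → ℝ} {W : ℕ → List ℕ → ℕ → Ω → ℝ} {S T : Set (ℕ ⊕ (ℕ × List ℕ × ℕ))}

lemma measurable_gapFamily_gapSigma {q : ℕ ⊕ (ℕ × List ℕ × ℕ)} (hq : q ∈ S) :
    Measurable[gapSigma R W S] (gapFamily R W q) :=
  Measurable.of_comap_le
    (le_iSup₂_of_le (f := fun q _ => MeasurableSpace.comap (gapFamily R W q) inferInstance) q hq
      le_rfl)

lemma gapSigma_mono (h : S ⊆ T) : gapSigma R W S ≤ gapSigma R W T :=
  biSup_mono h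

lemma measurableSet_raceGood {m' : MeasurableSpace Ω} {n : ℕ}
    (hR : ∀ k, n ≤ k → Measurable[m'] (R k)) (hW : ∀ i p c, n ≤ i → Measurable[m'] (W i p c))
    (Δ β γ K : ℝ) (j : ℕ) :
    MeasurableSet[m'] {ω | RaceGood Δ β γ K n j (fun k => R k ω) fun i p c => W i p c ω} := by
  have h : MeasurableSet[m'] {ω | ∀ i < j, n ≤ i → SparseTree β (K + K + β + Δ)
      (sparseThreshold γ K (j - i)) fun p c => W i p c ω} := by
    simp only [Set.ofPred_forall]
    exact MeasurableSet.iInter fun i => .iInter fun _ => .iInter fun hi =>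
      measurableSet_sparseTree (fun p c => hW i p c hi) _ _ _
  exact (measurableSet_honestGood hR Δ β γ K j).inter h

variable [mΩ : MeasurableSpace Ω] {μ : Measure Ω}

lemma gapSigma_le (hm : ∀ q, Measurable (gapFamily R W q)) : gapSigma R W S ≤ mΩ :=
  iSup₂_le fun q _ => (hm q).comap_le

lemma measure_inter_of_disjoint (hm : ∀ q, Measurable (gapFamily R W q))
    (hind : iIndepFun (gapFamily R W) μ) (hST : Disjoint S T) {A B : Set Ω}
    (hA : MeasurableSet[gapSigma R W S] A) (hB : MeasurableSet[gapSigma R W T] B) :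
    μ (A ∩ B) = μ A * μ B :=
  (Indep_iff _ _ _).1 (indep_iSup_of_disjoint (fun q => (hm q).comap_le) hind hST) A B hA hB

/-- The index of the honest block to which a gap belongs. -/
def gapLevel : ℕ ⊕ (ℕ × List ℕ × ℕ) → ℕ := Sum.elim id fun q => q.1

/-- Tree `j` uses gaps disjoint from the honest ones and from those of earlier trees, so trees can
be split off one at a time. -/
lemma measure_inter_biInter_tree (hm : ∀ q, Measurable (gapFamily R W q))
    (hind : iIndepFun (gapFamily R W) μ) {A : Set Ω}
    (hA : MeasurableSet[gapSigma R W (Set.range Sum.inl)] A) {V : ℕ → Set Ω}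
    (hV : ∀ i, MeasurableSet[gapSigma R W (Set.range fun q : List ℕ × ℕ => Sum.inr (i, q))] (V i))
    (j : ℕ) : μ (A ∩ ⋂ i < j, V i) = μ A * ∏ i ∈ Finset.range j, μ (V i) := by
  let S : ℕ → Set (ℕ ⊕ (ℕ × List ℕ × ℕ)) := fun j =>
    Set.range Sum.inl ∪ {q | ∃ x : ℕ × List ℕ × ℕ, x.1 < j ∧ q = Sum.inr x}
  induction j with
  | zero => simp
  | succ j ih =>
    have hset : A ∩ ⋂ i < j + 1, V i = (A ∩ ⋂ i < j, V i) ∩ V j := by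
      rw [Set.biInter_lt_succ, Set.inter_assoc]
    have hmeas : MeasurableSet[gapSigma R W (S j)] (A ∩ ⋂ i < j, V i) := by
      refine MeasurableSet.inter (gapSigma_mono Set.subset_union_left _ hA) ?_
      refine MeasurableSet.iInter fun i => MeasurableSet.iInter fun hi =>
        gapSigma_mono ?_ _ (hV i)
      rintro _ ⟨q, rfl⟩
      exact Or.inr ⟨(i, q), hi, rfl⟩
    have hdisj : Disjoint (S j) (Set.range fun q : List ℕ × ℕ => Sum.inr (j, q)) := by
      rw [Set.disjoint_left]
      rintro _ (⟨k, rfl⟩ | ⟨x, hx, rfl⟩) ⟨q, hq⟩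
      · simp at hq
      · have := Sum.inr.inj hq
        rw [← this] at hx
        exact lt_irrefl _ hx
    rw [hset, measure_inter_of_disjoint hm hind hdisj hmeas (hV j), ih, Finset.prod_range_succ,
      mul_assoc]

/-- A zero-one law for events which for every `n` are determined by the gaps of level at
least `n`. -/
lemma measure_zero_or_one_of_gapLevel (hm : ∀ q, Measurable (gapFamily R W q))
    (hind : iIndepFun (gapFamily R W) μ) {A : Set Ω}
    (hA : ∀ n, MeasurableSet[gapSigma R W {q | n ≤ gapLevel q}] A) : μ A = 0 ∨ μ A = 1 := by
  -- The tail is taken along the level: sets of gaps of bounded level are directed and exhaust all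
  -- gaps.
  refine measure_zero_or_one_of_measurableSet_limsup (fun q => (hm q).comap_le) hind
    (f := comap gapLevel atTop) (p := fun t => ∃ n, ∀ q ∈ t, gapLevel q < n)
    (ns := fun n : ℕ => {q | gapLevel q < n}) ?_ ?_ (fun n => ⟨n, fun q hq => hq⟩)
    (fun q => ⟨gapLevel q + 1, Nat.lt_succ_self _⟩) ?_
  · rintro t ⟨n, hn⟩
    exact ⟨Set.Ici n, Ici_mem_atTop n, fun q hq hqt => (hn q hqt).not_ge hq⟩
  · exact Monotone.directed_le fun a b hab q (hq : _ < a) => lt_of_lt_of_le hq hab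
  · rw [(atTop_basis.comap gapLevel).limsup_eq_iInf_iSup, MeasurableSpace.measurableSet_iInf]
    intro n
    rw [MeasurableSpace.measurableSet_iInf]
    intro _
    exact hA n

end Independence

/-! ### Positive probability, then probability one. -/

section Main

variable {Ω : Type*} [MeasurableSpace Ω] {μ : Measure Ω}
  {R : ℕ → Ω → ℝ} {W : ℕ → List ℕ → ℕ → Ω → ℝ} {lamH lamA Δ : ℝ}

lemma IsMiningModel.iIndepFun_honest (h : IsMiningModel μ lamH lamA R W) : iIndepFun R μ :=
  h.indep.precomp (g := Sum.inl) Sum.inl_injective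

lemma IsMiningModel.iIndepFun_tree (h : IsMiningModel μ lamH lamA R W) (i : ℕ) :
    iIndepFun (fun q : List ℕ × ℕ => W i q.1 q.2) μ :=
  h.indep.precomp (g := fun q : List ℕ × ℕ => Sum.inr (i, q)) fun a b hab => by simpa using hab

variable [IsProbabilityMeasure μ]

lemma IsMiningModel.exists_measure_raceGood_ge (h : IsMiningModel μ lamH lamA R W)
    (hR : ∀ k, Measurable (R k)) (hW : ∀ i p c, Measurable (W i p c))
    (hlamH : 0 < lamH) (hlamA : 0 < lamA) (hΔ : 0 ≤ Δ) {β γ : ℝ} (hβ : 0 < β) (hγ : 0 < γ)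
    (hβr : 1 / lamH < β * Real.exp (-(lamH * Δ))) (hγr : γ < Real.exp (-(lamH * Δ)))
    (hβa : β * Real.exp 1 * lamA < 1) :
    ∃ K : ℝ, ∃ p : ℝ≥0∞, 0 < p ∧ ∀ j ≥ 1,
      p ≤ μ {ω | RaceGood Δ β γ K 0 j (fun k => R k ω) fun i p c => W i p c ω} := by
  have hm : ∀ q, Measurable (gapFamily R W q) := by
    rintro (k | q)
    exacts [hR k, hW _ _ _]
  obtain ⟨K, -, p, hp, hpj⟩ := exists_measure_honestGood_ge hR h.honest_law h.iIndepFun_honest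
    hlamH hΔ hβ.le hγ.le hβr hγr
  obtain ⟨f, hf0, hf1, hfs, hf⟩ := exists_measureReal_sparseThreshold_ge K (K + K + β + Δ)
    hlamA hβ hγ hβa hW h.adv_law h.iIndepFun_tree
  obtain ⟨r, hr, hrf⟩ := exists_pos_le_prod (f := fun l => f (l + 1)) (fun l => hf0 _)
    (fun l => hf1 _) ((summable_nat_add_iff 1).2 hfs)
  refine ⟨K, p * ENNReal.ofReal r, ENNReal.mul_pos hp.ne' (by simpa using hr), fun j hj => ?_⟩
  let V : ℕ → Set Ω := fun i => {ω | SparseTree β (K + K + β + Δ) (sparseThreshold γ K (j - i))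
    fun p c => W i p c ω}
  have hset : {ω | RaceGood Δ β γ K 0 j (fun k => R k ω) fun i p c => W i p c ω} =
      {ω | HonestGood Δ β γ K 0 j fun k => R k ω} ∩ ⋂ i < j, V i := by
    ext ω
    simp [RaceGood, V]
  have hA : MeasurableSet[gapSigma R W (Set.range Sum.inl)]
      {ω | HonestGood Δ β γ K 0 j fun k => R k ω} :=
    measurableSet_honestGood (mΩ := gapSigma R W (Set.range Sum.inl))
      (fun k _ => measurable_gapFamily_gapSigma (q := Sum.inl k) ⟨k, rfl⟩) Δ β γ K j
  have hV : ∀ i, MeasurableSet[gapSigma R W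
      (Set.range fun q : List ℕ × ℕ => Sum.inr (i, q))] (V i) := fun i =>
    measurableSet_sparseTree (mΩ := gapSigma R W (Set.range fun q : List ℕ × ℕ => Sum.inr (i, q)))
      (fun p c => measurable_gapFamily_gapSigma (q := Sum.inr (i, p, c)) ⟨(p, c), rfl⟩) _ _ _
  rw [hset, measure_inter_biInter_tree hm h.indep hA hV]
  refine mul_le_mul' (hpj j hj) ?_
  calc ENNReal.ofReal r ≤ ENNReal.ofReal (∏ l ∈ Finset.range j, f (l + 1)) :=
        ENNReal.ofReal_le_ofReal (hrf j)
    _ = ∏ l ∈ Finset.range j, ENNReal.ofReal (f (l + 1)) :=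
        ENNReal.ofReal_prod_of_nonneg fun l _ => (hf0 _).le
    _ = ∏ i ∈ Finset.range j, ENNReal.ofReal (f (j - i)) := by
        -- Reflection turns the index `i` into the distance `j - i`, which runs from `1` to `j`.
        rw [← Finset.prod_range_reflect]
        refine Finset.prod_congr rfl fun i hi => ?_
        have := Finset.mem_range.1 hi
        congr 2
        omega
    _ ≤ ∏ i ∈ Finset.range j, μ (V i) := by
        refine Finset.prod_le_prod' fun i _ => ?_
        rw [← ofReal_measureReal (measure_ne_top μ (V i))]
        exact ENNReal.ofReal_le_ofReal (hf i (j - i))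

lemma IsMiningModel.ae_infinite (h : IsMiningModel μ lamH lamA R W)
    (hR : ∀ k, Measurable (R k)) (hW : ∀ i p c, Measurable (W i p c))
    (hlamH : 0 < lamH) (hlamA : 0 < lamA) (hΔ : 0 ≤ Δ)
    (hrate : lamA / lamH * Real.exp 1 < Real.exp (-lamH * Δ)) :
    ∀ᵐ ω ∂μ, {j : ℕ | AdversaryProofConvergence Δ (fun k => R k ω)
      (fun i p c => W i p c ω) j}.Infinite := by
  have hg : 0 < Real.exp (-(lamH * Δ)) := Real.exp_pos _
  rw [neg_mul] at hrate
  set g := Real.exp (-(lamH * Δ)) with hgdef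
  have he : 0 < Real.exp 1 := Real.exp_pos 1
  -- The rate hypothesis is exactly what makes this interval nonempty.
  obtain ⟨β, hβ1, hβ2⟩ : ∃ β, 1 / (lamH * g) < β ∧ β < 1 / (Real.exp 1 * lamA) := by
    refine exists_between (one_div_lt_one_div_of_lt (by positivity) ?_)
    rw [div_mul_eq_mul_div, div_lt_iff₀ hlamH] at hrate
    linarith
  have hβ : 0 < β := lt_trans (by positivity) hβ1
  have hβr : 1 / lamH < β * g := by
    rw [div_lt_iff₀ (by positivity)] at hβ1 ⊢
    linarith
  have hβa : β * Real.exp 1 * lamA < 1 := by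
    rw [lt_div_iff₀ (by positivity)] at hβ2
    linarith
  have hγ : 0 < g / 2 := by positivity
  have hm : ∀ q, Measurable (gapFamily R W q) := by
    rintro (k | q)
    exacts [hR k, hW _ _ _]
  obtain ⟨K, p, hp, hpj⟩ := h.exists_measure_raceGood_ge hR hW hlamH hlamA hΔ hβ hγ hβr
    (half_lt_self hg) hβa
  let G : ℕ → ℕ → Set Ω := fun n j =>
    {ω | RaceGood Δ β (g / 2) K n j (fun k => R k ω) fun i p c => W i p c ω}
  let T : ℕ → Set Ω := fun n => {ω | ∃ᶠ j in atTop, ω ∈ G n j}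
  -- Raising `n` drops conditions; the remaining requirement `n' < j` holds for all large `j`.
  have hTmono : Monotone T := by
    intro n n' hn ω hω
    exact (Filter.Frequently.and_eventually hω (eventually_gt_atTop n')).mono
      fun j hj => RaceGood.mono hj.1 hn hj.2
  have hTmeas : ∀ n, MeasurableSet[gapSigma R W {q | n ≤ gapLevel q}] (T n) := by
    intro n
    have hG : ∀ j, MeasurableSet[gapSigma R W {q | n ≤ gapLevel q}] (G n j) := fun j =>
      measurableSet_raceGood
        (fun k hk => measurable_gapFamily_gapSigma (q := Sum.inl k) hk)
        (fun i p c hi => measurable_gapFamily_gapSigma (q := Sum.inr (i, p, c)) hi) Δ β (g / 2) K j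
    simp only [T, frequently_atTop, Set.ofPred_forall, Set.ofPred_exists]
    exact MeasurableSet.iInter fun a => .iUnion fun b => (MeasurableSet.const _).inter (hG b)
  have hpos : 0 < μ (⋃ n, T n) := by
    refine lt_of_lt_of_le hp (le_trans ?_ (measure_mono (Set.subset_iUnion T 0)))
    exact le_measure_frequently (fun j => measurableSet_raceGood (fun k _ => hR k)
      (fun i p c _ => hW i p c) Δ β (g / 2) K j) ((eventually_ge_atTop 1).mono hpj)
  have htail : ∀ n, MeasurableSet[gapSigma R W {q | n ≤ gapLevel q}] (⋃ n, T n) := by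
    intro n
    -- By monotonicity the first `n` sets may be dropped from the union, which leaves only gaps of
    -- level at least `n`.
    have hshift : ⋃ m, T m = ⋃ m, T (m + n) := by
      refine Set.Subset.antisymm (Set.iUnion_subset fun m => ?_)
        (Set.iUnion_subset fun m => Set.subset_iUnion T _)
      exact (hTmono (Nat.le_add_right m n)).trans (Set.subset_iUnion (fun m => T (m + n)) m)
    rw [hshift]
    exact MeasurableSet.iUnion fun m =>
      gapSigma_mono (fun q (hq : m + n ≤ _) => (Nat.le_add_left n m).trans hq) _ (hTmeas _)
  have hone := (measure_zero_or_one_of_gapLevel hm h.indep htail).resolve_left hpos.ne'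
  have haeT : ∀ᵐ ω ∂μ, ω ∈ ⋃ n, T n :=
    (mem_ae_iff_prob_eq_one (gapSigma_le hm _ (htail 0))).2 hone
  have hsparse : ∀ᵐ ω ∂μ, ∀ i, ∀ L : ℕ, ∃ n₀, SparseTree β L n₀ fun p c => W i p c ω :=
    ae_all_iff.2 fun i => ae_all_iff.2 fun L =>
      ae_exists_sparseTree L hlamA hβ hβa (hW i) (h.adv_law i) (h.iIndepFun_tree i)
  filter_upwards [haeT, hsparse, ae_all_iff.2 fun k => ae_gap_pos hlamH (hR k) (h.honest_law k),
    ae_tendsto_honestTime hlamH hR h.honest_law h.iIndepFun_honest] with ω h1 h2 h3 h4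
  obtain ⟨n, hn⟩ := Set.mem_iUnion.1 h1
  exact infinite_adversaryProofConvergence h3 h4 hβ.le hγ h2 hn

end Main

end NakamotoPoS

theorem mainTheorem7 {Ω : Type*} [MeasurableSpace Ω] (μ : MeasureTheory.Measure Ω)
    [MeasureTheory.IsProbabilityMeasure μ] (lamH lamA Δ : ℝ)
    (hlamH : 0 < lamH) (hlamA : 0 < lamA) (hΔ : 0 ≤ Δ)
    (hrate : lamA / lamH * Real.exp 1 < Real.exp (-lamH * Δ))
    (R : ℕ → Ω → ℝ) (W : ℕ → List ℕ → ℕ → Ω → ℝ)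
    (hmodel : NakamotoPoS.IsMiningModel μ lamH lamA R W) :
    ∀ᵐ ω ∂μ,
      {j : ℕ | NakamotoPoS.AdversaryProofConvergence Δ (fun k => R k ω)
        (fun i p c => W i p c ω) j}.Infinite := by
  have hR : ∀ k, AEMeasurable (R k) μ := fun k => (hmodel.honest_law k).aemeasurable
  have hW : ∀ i p c, AEMeasurable (W i p c) μ := fun i p c => (hmodel.adv_law i p c).aemeasurable
  -- The gaps are only a.e. measurable; measurable versions have the same laws and independence, and
  -- all countably many agree simultaneously almost surely.
  have hmodel' : NakamotoPoS.IsMiningModel μ lamH lamA (fun k => (hR k).mk)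
      (fun i p c => (hW i p c).mk) :=
    { honest_law := fun k => (hmodel.honest_law k).congr (hR k).ae_eq_mk.symm
      adv_law := fun i p c => (hmodel.adv_law i p c).congr (hW i p c).ae_eq_mk.symm
      indep := by
        refine hmodel.indep.congr ?_
        rintro (k | q)
        exacts [(hR k).ae_eq_mk, (hW _ _ _).ae_eq_mk] }
  have hae := hmodel'.ae_infinite (fun k => (hR k).measurable_mk)
    (fun i p c => (hW i p c).measurable_mk) hlamH hlamA hΔ hrate
  filter_upwards [hae, ae_all_iff.2 fun k => (hR k).ae_eq_mk,
    ae_all_iff.2 fun i => ae_all_iff.2 fun p => ae_all_iff.2 fun c => (hW i p c).ae_eq_mk]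
    with ω h1 h2 h3
  simp only [h2, h3]
  exact h1
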